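/- For integers $0\le m\le q$, $0\le n\le p$ and complex parameters $a_1,\dots,a_p$, $b_1,\dots,b_q$ such that $a_i-b_j$ is not a positive integer for $i\le n$, $j\le m$, the Meijer $G$-function is $$G^{m,n}_{p,q}\Big({a_1,\dots,a_p\atop b_1,\dots,b_q}\Big|z\Big)=\frac1{2\pi i}\int_L z^s\,\frac{\prod_{l=1}^m\Gamma(b_l-s)\prod_{l=1}^n\Gamma(1-a_l+s)}{\prod_{l=m+1}^q\Gamma(1-b_l+s)\prod_{l=n+1}^p\Gamma(a_l-s)}\,ds,\qquad z\neq0,$$ where a value of $\log z$ (hence of $\arg z$ and of $z^s=e^{s\log z}$) is fixed and the path $L$ separates the poles of the $\Gamma(b_l-s)$, $l\le m$, from those of the $\Gamma(1-a_l+s)$, $l\le n$. Here $L$ is of one of the following kinds (piecewise $C^1$, with ends on straight lines parallel to the indicated direction): (i) from $-i\infty$ to $i\infty$, with the poles of the $\Gamma(1-a_l+s)$ on its left and those of the $\Gamma(b_l-s)$ on its right, if $p+q<2(m+n)$ and $|\arg z|<(m+n-\tfrac12(p+q))\pi$; (ii) a loop from and to $+\infty$ encircling the poles of the $\Gamma(b_l-s)$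 once in the negative sense and not encircling the other poles, if $p<q$, or $p=q\ge1$ and $|z|<1$; (iii) a loop from and to $-\infty$ encircling the poles of the $\Gamma(1-a_l+s)$ once in the positive sense and not encircling the other poles, if $p>q$, or $p=q\ge1$ and $|z|>1$. **Proposition.** Let $p\ge n\ge0$, $q\ge m\ge0$ and let $\boldsymbol a=(a_1,\dots,a_{p+1})$, $\boldsymbol b=(b_1,\dots,b_{q+1})$ be complex parameters such that $a_{n+1}-b_{m+1}=k$ is a positive integer, while $a_i-b_j$ is not a positive integer for all other pairs $(i,j)$ with $1\le i\le n+1$, $1\le j\le m+1$. Let $z\neq0$ with a fixed value of $\log z$. Then, for any paths $L_1$ and $L_2$ as above for $G^{m,n+1}_{p+1,q+1}$ and $G^{m+1,n}_{p+1,q+1}$ respectively, the integrals defining these two functions at $z$ converge absolutely and $$G^{m,n+1}_{p+1,q+1}\Big({\boldsymbol a\atop\boldsymbol b}\Big|z\Big)-(-1)^{k}\,G^{m+1,n}_{p+1,q+1}\Big({\boldsymbol a\atop\boldsymbol b}\Big|z\Big)=\sum_{c}(-1)^{a_{n+1}-1-c}\,\frac{\prod_{l=1}^m\Gamma(b_l-c)\prod_{l=1}^n\Gamma(1-a_l+c)}{\prod_{l=m+1}^{q+1}\Gamma(1-b_l+c)\prod_{l=n+1}^{p+1}\Gamma(a_l-c)}\,z^c,$$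 where $c$ runs over $b_{m+1},\,b_{m+1}+1,\,\dots,\,a_{n+1}-1$ in integer steps. -/

import Mathlib

open scoped BigOperators Topology

noncomputable section

namespace MeijerG

/-- The Mellin-Barnes integrand of `G^{m,n}_{p,q}` with upper parameters `a_1, …, a_p` and lower
parameters `b_1, …, b_q` (`a_l` is `a ⟨l - 1, _⟩`, `b_l` is `b ⟨l - 1, _⟩`) at the point `s`:
`z^s ∏_{l ≤ m} Γ(b_l - s) ∏_{l ≤ n} Γ(1 - a_l + s) / (∏_{l > m} Γ(1 - b_l + s) ∏_{l > n} Γ(a_l - s))`.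
The power `z^s` of the argument `z ≠ 0` depends on a choice of `log z`. The variable `ω` is that
choice: `z = exp ω`, `arg z = ω.im`, `|z| = exp ω.re` and `z^s = exp (s * ω)`. The principal branch
is `ω = Complex.log z`. -/
def integrand (m n : ℕ) {p q : ℕ} (a : Fin p → ℂ) (b : Fin q → ℂ) (ω s : ℂ) : ℂ :=
  Complex.exp (s * ω) *
    (((∏ l : Fin q with l.val < m, Complex.Gamma (b l - s)) *
        (∏ l : Fin p with l.val < n, Complex.Gamma (1 - a l + s))) /
      ((∏ l : Fin q with m ≤ l.val, Complex.Gamma (1 - b l + s)) *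
        (∏ l : Fin p with n ≤ l.val, Complex.Gamma (a l - s))))

/-- The poles of the factors `Γ(1 - a_l + s)`, `1 ≤ l ≤ n`, of the integrand. -/
def leftPoles (n : ℕ) {p : ℕ} (a : Fin p → ℂ) : Set ℂ :=
  {s | ∃ l : Fin p, l.val < n ∧ ∃ r : ℕ, s = a l - 1 - r}

/-- The poles of the factors `Γ(b_l - s)`, `1 ≤ l ≤ m`, of the integrand. -/
def rightPoles (m : ℕ) {q : ℕ} (b : Fin q → ℂ) : Set ℂ :=
  {s | ∃ l : Fin q, l.val < m ∧ ∃ r : ℕ, s = b l + r}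

/-- Piecewise continuously differentiable curves (with locally bounded derivative). -/
def IsPiecewiseC1 (γ : ℝ → ℂ) : Prop :=
  LocallyLipschitz γ ∧ ∃ S : Set ℝ, S.Finite ∧ ∀ t, t ∉ S → ContDiffAt ℝ 1 γ t

/-- The curve `γ` avoids the point `w`, and `arg (γ t - w)` changes in total by `θ` when `t` runs
from `-∞` to `∞`. -/
def ArgChange (γ : ℝ → ℂ) (w : ℂ) (θ : ℝ) : Prop :=
  (∀ t, γ t ≠ w) ∧
    Filter.Tendsto (fun R : ℝ => (∫ t in (-R)..R, deriv γ t / (γ t - w)).im)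
      Filter.atTop (𝓝 θ)

/-- `γ` goes from `-i∞` to `i∞`, with both ends on lines parallel to the imaginary axis. -/
def IsVertical (γ : ℝ → ℂ) : Prop :=
  ∃ x₁ x₂ T : ℝ, (∀ t, t ≤ -T → γ t = x₁ + t * Complex.I) ∧
    (∀ t, T ≤ t → γ t = x₂ + t * Complex.I)

/-- `γ` starts at infinity on a line parallel to the positive real axis and returns to infinity on
another such line. -/
def IsRightLoop (γ : ℝ → ℂ) : Prop :=
  ∃ y₁ y₂ T : ℝ, (∀ t : ℝ, t ≤ -T → γ t = -t + y₁ * Complex.I) ∧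
    (∀ t : ℝ, T ≤ t → γ t = t + y₂ * Complex.I)

/-- `γ` starts at infinity on a line parallel to the negative real axis and returns to infinity on
another such line. -/
def IsLeftLoop (γ : ℝ → ℂ) : Prop :=
  ∃ y₁ y₂ T : ℝ, (∀ t : ℝ, t ≤ -T → γ t = t + y₁ * Complex.I) ∧
    (∀ t : ℝ, T ≤ t → γ t = -t + y₂ * Complex.I)

/-- The integration paths of the Mellin-Barnes integral that defines `G^{m,n}_{p,q}` at
`z = exp ω`. They separate the poles of the `Γ(b_l - s)` from those of the `Γ(1 - a_l + s)`.
There are three kinds: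

* from `-i∞` to `i∞`, when `p + q < 2 (m + n)` and `|arg z| < (m + n - (p + q) / 2) π`. A point lies
  to the left of such a path if `arg (γ t - w)` increases by `π`, to the right if it decreases
  by `π`;
* a loop from and to `+∞` that encircles the poles of the `Γ(b_l - s)` once in the negative sense
  and does not encircle the others, when `p < q`, or `p = q ≥ 1` and `|z| < 1`;
* a loop from and to `-∞` that encircles the poles of the `Γ(1 - a_l + s)` once in the positive
  sense and does not encircle the others, when `q < p`, or `p = q ≥ 1` and `1 < |z|`. -/
def IsContour (m n : ℕ) {p q : ℕ} (a : Fin p → ℂ) (b : Fin q → ℂ) (ω : ℂ) (γ : ℝ → ℂ) : Prop :=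
  IsPiecewiseC1 γ ∧
    ((IsVertical γ ∧
        p + q < 2 * (m + n) ∧
        |ω.im| < ((m : ℝ) + n - ((p : ℝ) + q) / 2) * Real.pi ∧
        (∀ w ∈ leftPoles n a, ArgChange γ w Real.pi) ∧
        (∀ w ∈ rightPoles m b, ArgChange γ w (-Real.pi))) ∨
      (IsRightLoop γ ∧
        (p < q ∨ (p = q ∧ 1 ≤ p ∧ ‖Complex.exp ω‖ < 1)) ∧
        (∀ w ∈ leftPoles n a, ArgChange γ w 0) ∧
        (∀ w ∈ rightPoles m b, ArgChange γ w (-(2 * Real.pi)))) ∨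
      (IsLeftLoop γ ∧
        (q < p ∨ (p = q ∧ 1 ≤ p ∧ 1 < ‖Complex.exp ω‖)) ∧
        (∀ w ∈ leftPoles n a, ArgChange γ w (2 * Real.pi)) ∧
        (∀ w ∈ rightPoles m b, ArgChange γ w 0)))

/-- The Mellin-Barnes integral along `γ` converges (absolutely). -/
def Converges (m n : ℕ) {p q : ℕ} (a : Fin p → ℂ) (b : Fin q → ℂ) (ω : ℂ) (γ : ℝ → ℂ) : Prop :=
  MeasureTheory.Integrable (fun t : ℝ => integrand m n a b ω (γ t) * deriv γ t)

/-- The Meijer function `G^{m,n}_{p,q}(a; b | z)` at `z = exp ω`, as the Mellin-Barnes integral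
`(2πi)⁻¹ ∫_γ` of the integrand along the integration path `γ`. -/
def meijerG (m n : ℕ) {p q : ℕ} (a : Fin p → ℂ) (b : Fin q → ℂ) (ω : ℂ) (γ : ℝ → ℂ) : ℂ :=
  (2 * Real.pi * Complex.I)⁻¹ * ∫ t : ℝ, integrand m n a b ω (γ t) * deriv γ t

end MeijerG

end

/-!
As `a_{n+1} = b_{m+1} + k`, the functional equation of `Γ` shows that the two integrands agree, up
to the sign `(-1)^k`, with one function `g` that has at most simple poles at
`c = b_{m+1}, …, a_{n+1} - 1`. Both paths separate the other poles of `g` in the same way, but these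
`k` points lie to the left of `γ₁` and to the right of `γ₂`, so that the difference of the integrals
is the sum of the residues there.

To make this precise, let `p ≤ q`, with `|z| ≤ 1` if `p = q`. The integral along either path, cut
off by a vertical line `re s = X`, is a sum of residues weighted by the changes of argument plus an
integral over a part of that line. As `X → ∞` in steps of `1` the latter tends to `0` whenever a
loop is involved, while for two vertical paths it is the same for both. The weights of the two paths
differ by the same amount at those `k` poles, and agree at all others. The necessary growth of `Γ`
follows from the beta integral and the reflection formula. The reflection `s ↦ -s` exchanges `p` and
`q` and inverts `z`, which covers the remaining parameters, and with them all left loops.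
-/

noncomputable section
namespace MeijerG

open Complex Filter MeasureTheory ProbabilityTheory Set
open scoped Real

/-! ### Growth of the Gamma function -/

theorem beta_eq_integral {x y : ℝ} (hx : 0 < x) (hy : 0 < y) :
    beta x y = ∫ t in (0 : ℝ)..1, t ^ (x - 1) * (1 - t) ^ (y - 1) := by
  rw [beta_eq_betaIntegralReal x y hx hy, betaIntegral,
    ← ofReal_re (∫ t in (0 : ℝ)..1, t ^ (x - 1) * (1 - t) ^ (y - 1)),
    ← intervalIntegral.integral_ofReal]
  congr 1
  refine intervalIntegral.integral_congr fun t ht => ?_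
  rw [uIcc_of_le zero_le_one] at ht
  push_cast [ofReal_cpow ht.1, ofReal_cpow (sub_nonneg.2 ht.2)]
  rfl

theorem norm_betaIntegral_le {u v : ℂ} {x : ℝ} (hx : 0 < x) (hxu : x ≤ u.re) (hv : 0 < v.re) :
    ‖betaIntegral u v‖ ≤ beta x v.re := by
  have hne : ∫ t in (0 : ℝ)..1, t ^ (x - 1) * (1 - t) ^ (v.re - 1) ≠ 0 :=
    beta_eq_integral hx hv ▸ (beta_pos hx hv).ne'
  rw [beta_eq_integral hx hv]
  refine intervalIntegral.norm_integral_le_of_norm_le zero_le_one ?_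
    (intervalIntegral.intervalIntegrable_of_integral_ne_zero hne)
  filter_upwards [compl_mem_ae_iff.2 (measure_singleton (1 : ℝ))] with t ht1 ht
  have ht0 : 0 < t := ht.1
  have ht1' : 0 < 1 - t := sub_pos.2 (lt_of_le_of_ne ht.2 ht1)
  rw [norm_mul, ← ofReal_one, ← ofReal_sub, norm_cpow_eq_rpow_re_of_pos ht0,
    norm_cpow_eq_rpow_re_of_pos ht1', sub_re, sub_re, ofReal_re]
  gcongr ?_ * _
  exact Real.rpow_le_rpow_of_exponent_ge ht0 ht.2 (by gcongr)

theorem norm_Gamma_mul_norm_Gamma_le {s t : ℂ} {x : ℝ} (hx : 0 < x) (hs : x ≤ s.re)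
    (ht : 0 < t.re) : ‖Gamma s‖ * ‖Gamma t‖ ≤ ‖Gamma (s + t)‖ * beta x t.re := by
  rw [← norm_mul, Gamma_mul_Gamma_eq_betaIntegral (hx.trans_le hs) ht, norm_mul]
  gcongr
  exact norm_betaIntegral_le hx hs ht

theorem norm_Gamma_one_add_mul_I_sq_mul_sinh (y : ℝ) :
    ‖Gamma (1 + y * I)‖ ^ 2 * Real.sinh (π * y) = π * y := by
  rcases eq_or_ne y 0 with rfl | hy
  · simp
  have hsinh : Real.sinh (π * y) ≠ 0 := by simp [hy, Real.pi_ne_zero]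
  have hsin : Complex.sin (π * (y * I)) = Real.sinh (π * y) * I := by
    rw [← mul_assoc, sin_mul_I]; push_cast; rfl
  have hconj : Gamma (1 - y * I) = (starRingEnd ℂ) (Gamma (1 + y * I)) := by
    rw [← Gamma_conj]; simp [sub_eq_add_neg]
  have hsucc : Gamma (1 + y * I) = y * I * Gamma (y * I) := by
    rw [add_comm, Gamma_add_one _ (by simp [hy])]
  have hnorm : ((‖Gamma (1 + y * I)‖ ^ 2 : ℝ) : ℂ) = y * I * (π / Complex.sin (π * (y * I))) := by
    rw [← Gamma_mul_Gamma_one_sub, ← mul_assoc, ← hsucc, hconj, mul_conj, normSq_eq_norm_sq]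
  have hsinh' : ((Real.sinh (π * y) : ℝ) : ℂ) ≠ 0 := ofReal_ne_zero.2 hsinh
  rw [hsin] at hnorm
  apply ofReal_injective
  rw [ofReal_mul, hnorm, ofReal_mul]
  field_simp

theorem sinh_le_mul_exp (x : ℝ) : Real.sinh x ≤ x * Real.exp x := by
  have hexp : Real.exp (-x) = Real.exp x * Real.exp (-(2 * x)) := by
    rw [← Real.exp_add]; ring_nf
  rw [Real.sinh_eq, hexp]
  nlinarith [Real.exp_pos x, Real.add_one_le_exp (-(2 * x))]

theorem exp_le_norm_Gamma_one_add_mul_I (y : ℝ) :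
    Real.exp (-(π / 2 * |y|)) ≤ ‖Gamma (1 + y * I)‖ := by
  rcases eq_or_ne y 0 with rfl | hy
  · simp
  have hpos : 0 < π * |y| := mul_pos Real.pi_pos (abs_pos.2 hy)
  have hkey : ‖Gamma (1 + y * I)‖ ^ 2 * Real.sinh (π * |y|) = π * |y| := by
    have h := congrArg abs (norm_Gamma_one_add_mul_I_sq_mul_sinh y)
    rwa [abs_mul, Real.abs_sinh, abs_mul, abs_of_pos Real.pi_pos, abs_of_nonneg (by positivity)]
      at h
  have hone : 1 ≤ ‖Gamma (1 + y * I)‖ ^ 2 * Real.exp (π * |y|) := by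
    refine le_of_mul_le_mul_right ?_ hpos
    calc 1 * (π * |y|) = ‖Gamma (1 + y * I)‖ ^ 2 * Real.sinh (π * |y|) := by rw [hkey, one_mul]
      _ ≤ ‖Gamma (1 + y * I)‖ ^ 2 * (π * |y| * Real.exp (π * |y|)) := by
        gcongr; exact sinh_le_mul_exp _
      _ = _ := by ring
  refine (sq_le_sq₀ (Real.exp_pos _).le (norm_nonneg _)).1 ?_
  calc Real.exp (-(π / 2 * |y|)) ^ 2 = (Real.exp (π * |y|))⁻¹ := by
        rw [← Real.exp_neg, ← Real.exp_nat_mul]; congr 1; push_cast; ring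
    _ ≤ _ := (inv_le_iff_one_le_mul₀ (Real.exp_pos _)).2 hone

theorem exp_mul_Gamma_re_le_norm_Gamma {s : ℂ} (hs : 1 ≤ s.re) :
    Real.exp (-(π / 2 * |s.im|)) * Real.Gamma s.re ≤ ‖Gamma s‖ := by
  have hline := exp_le_norm_Gamma_one_add_mul_I s.im
  rcases hs.eq_or_lt with hs1 | hs1
  · have hs' : 1 + s.im * I = s := by apply Complex.ext <;> simp [← hs1]
    rwa [← hs1, Real.Gamma_one, mul_one, ← congrArg (‖Gamma ·‖) hs']
  have hx : 0 < s.re - 1 := sub_pos.2 hs1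
  have hGx : 0 < Real.Gamma (s.re - 1) := Real.Gamma_pos_of_pos hx
  have hG : 0 < Real.Gamma s.re := Real.Gamma_pos_of_pos (one_pos.trans hs1)
  have hs' : 1 + s.im * I + ((s.re - 1 : ℝ) : ℂ) = s := by apply Complex.ext <;> simp
  have hbeta := norm_Gamma_mul_norm_Gamma_le (s := 1 + s.im * I) (t := ((s.re - 1 : ℝ) : ℂ))
    one_pos (by simp) (by simpa using hs1)
  rw [hs', Gamma_ofReal, norm_real, ofReal_re, beta, Real.Gamma_one, add_sub_cancel, one_mul,
    Real.norm_of_nonneg hGx.le, mul_div_assoc', le_div_iff₀ hG, mul_right_comm] at hbeta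
  exact (mul_le_mul_of_nonneg_right hline hG.le).trans (le_of_mul_le_mul_right hbeta hGx)

theorem norm_inv_Gamma_le {s : ℂ} (hs : 1 ≤ s.re) :
    ‖(Gamma s)⁻¹‖ ≤ Real.exp (π / 2 * |s.im|) * (Real.Gamma s.re)⁻¹ := by
  have hG : 0 < Real.Gamma s.re := Real.Gamma_pos_of_pos (by linarith)
  rw [norm_inv]
  calc ‖Gamma s‖⁻¹ ≤ (Real.exp (-(π / 2 * |s.im|)) * Real.Gamma s.re)⁻¹ :=
        inv_anti₀ (mul_pos (Real.exp_pos _) hG) (exp_mul_Gamma_re_le_norm_Gamma hs)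
    _ = _ := by rw [mul_inv, ← Real.exp_neg, neg_neg]

theorem exp_mul_rpow_le_Gamma {x T : ℝ} (hx : 1 ≤ x) (hT : 0 < T) :
    Real.exp (-(T + 1)) * T ^ (x - 1) ≤ Real.Gamma x := by
  have hint := Real.GammaIntegral_convergent (one_pos.trans_le hx)
  have hsub : Ioc T (T + 1) ⊆ Ioi 0 := fun t ht => hT.trans ht.1
  rw [Real.Gamma_eq_integral (one_pos.trans_le hx)]
  calc Real.exp (-(T + 1)) * T ^ (x - 1)
      = ∫ _ in Ioc T (T + 1), Real.exp (-(T + 1)) * T ^ (x - 1) := by simp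
    _ ≤ ∫ t in Ioc T (T + 1), Real.exp (-t) * t ^ (x - 1) := by
      refine setIntegral_mono_on (integrableOn_const (by simp)) (hint.mono_set hsub)
        measurableSet_Ioc fun t ht => ?_
      gcongr
      exacts [ht.2, ht.1.le]
    _ ≤ ∫ t in Ioi 0, Real.exp (-t) * t ^ (x - 1) := by
      refine setIntegral_mono_set hint ?_ hsub.eventuallyLE
      filter_upwards [ae_restrict_mem measurableSet_Ioi] with t ht
      exact mul_nonneg (Real.exp_pos _).le (Real.rpow_nonneg (le_of_lt ht) _)

theorem exists_inv_Gamma_le_exp (K : ℝ) :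
    ∃ C : ℝ, 0 ≤ C ∧ ∀ x : ℝ, 1 ≤ x → (Real.Gamma x)⁻¹ ≤ C * Real.exp (-K * x) := by
  refine ⟨Real.exp (Real.exp K + 1) * Real.exp K, by positivity, fun x hx => ?_⟩
  calc (Real.Gamma x)⁻¹
      ≤ (Real.exp (-(Real.exp K + 1)) * Real.exp K ^ (x - 1))⁻¹ :=
        inv_anti₀ (by positivity) (exp_mul_rpow_le_Gamma hx (Real.exp_pos K))
    _ = Real.exp (Real.exp K + 1) * Real.exp K * Real.exp (-K * x) := by
      rw [← Real.exp_mul, ← Real.exp_add, ← Real.exp_add, ← Real.exp_add, ← Real.exp_neg]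
      ring_nf

/-- The growth condition of all estimates below: on `D` the function `h` is bounded by a power of
`1 + ‖s‖` times `exp (u * re s + v * |im s|)`. -/
def ExpPolyBound (D : Set ℂ) (h : ℂ → ℂ) (u v : ℝ) : Prop :=
  ∃ (C : ℝ) (A : ℕ), 0 ≤ C ∧
    ∀ s ∈ D, ‖h s‖ ≤ C * (1 + ‖s‖) ^ A * Real.exp (u * s.re + v * |s.im|)

namespace ExpPolyBound

variable {D D' : Set ℂ} {h h' : ℂ → ℂ} {u v u' v' : ℝ}

theorem mono (H : ExpPolyBound D h u v) (hD : D' ⊆ D) : ExpPolyBound D' h u v := by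
  obtain ⟨C, A, hC, hbound⟩ := H
  exact ⟨C, A, hC, fun s hs => hbound s (hD hs)⟩

theorem of_norm_le (H : ExpPolyBound D h u v) (hle : ∀ s ∈ D, ‖h' s‖ ≤ ‖h s‖) :
    ExpPolyBound D h' u v := by
  obtain ⟨C, A, hC, hbound⟩ := H
  exact ⟨C, A, hC, fun s hs => (hle s hs).trans (hbound s hs)⟩

theorem of_norm_le_exp {C : ℝ} (hC : 0 ≤ C)
    (hle : ∀ s ∈ D, ‖h s‖ ≤ C * Real.exp (u * s.re + v * |s.im|)) : ExpPolyBound D h u v :=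
  ⟨C, 0, hC, fun s hs => by simpa using hle s hs⟩

theorem const (c : ℂ) : ExpPolyBound D (fun _ => c) 0 0 :=
  of_norm_le_exp (norm_nonneg c) (by simp)

theorem mul (H : ExpPolyBound D h u v) (H' : ExpPolyBound D h' u' v') :
    ExpPolyBound D (fun s => h s * h' s) (u + u') (v + v') := by
  obtain ⟨C, A, hC, hbound⟩ := H
  obtain ⟨C', A', hC', hbound'⟩ := H'
  refine ⟨C * C', A + A', mul_nonneg hC hC', fun s hs => ?_⟩
  have hexp : Real.exp ((u + u') * s.re + (v + v') * |s.im|) =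
      Real.exp (u * s.re + v * |s.im|) * Real.exp (u' * s.re + v' * |s.im|) := by
    rw [← Real.exp_add]; ring_nf
  calc ‖h s * h' s‖
      ≤ C * (1 + ‖s‖) ^ A * Real.exp (u * s.re + v * |s.im|) *
          (C' * (1 + ‖s‖) ^ A' * Real.exp (u' * s.re + v' * |s.im|)) := by
        rw [norm_mul]; gcongr; exacts [hbound s hs, hbound' s hs]
    _ = _ := by rw [hexp, pow_add]; ring

theorem prod {ι : Type*} (S : Finset ι) {f : ι → ℂ → ℂ}
    (H : ∀ i ∈ S, ExpPolyBound D (f i) u v) :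
    ExpPolyBound D (fun s => ∏ i ∈ S, f i s) (S.card * u) (S.card * v) := by
  classical
  induction S using Finset.induction_on with
  | empty => simpa using const (D := D) 1
  | insert i S hi ih =>
    have hmul := (H i (Finset.mem_insert_self i S)).mul
      (ih fun j hj => H j (Finset.mem_insert_of_mem hj))
    simp only [Finset.prod_insert hi, Finset.card_insert_of_notMem hi]
    convert hmul using 1 <;> push_cast <;> ring

end ExpPolyBound

theorem norm_prod_add_natCast_le (s β : ℂ) (J : ℕ) :
    ‖∏ j ∈ Finset.range J, (s + β + j)‖ ≤ (‖s‖ + (‖β‖ + J)) ^ J := by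
  rw [norm_prod]
  refine (Finset.prod_le_prod (g := fun _ => ‖s‖ + (‖β‖ + J)) (fun _ _ => norm_nonneg _)
    fun j hj => ?_).trans (by simp)
  have hjJ : (j : ℝ) ≤ J := by exact_mod_cast (Finset.mem_range.1 hj).le
  calc ‖s + β + j‖ ≤ ‖s‖ + ‖β‖ + ‖(j : ℂ)‖ := norm_add₃_le
    _ ≤ _ := by rw [norm_natCast]; linarith

theorem expPolyBound_prod_add_natCast (D : Set ℂ) (β : ℂ) (J : ℕ) :
    ExpPolyBound D (fun s => ∏ j ∈ Finset.range J, (s + β + j)) 0 0 := by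
  refine ⟨(1 + (‖β‖ + J)) ^ J, J, by positivity, fun s _ => ?_⟩
  calc ‖∏ j ∈ Finset.range J, (s + β + j)‖ ≤ (‖s‖ + (‖β‖ + J)) ^ J :=
        norm_prod_add_natCast_le s β J
    _ ≤ ((1 + (‖β‖ + J)) * (1 + ‖s‖)) ^ J := by
      gcongr
      nlinarith [norm_nonneg s, mul_nonneg (norm_nonneg β) (norm_nonneg s),
        mul_nonneg J.cast_nonneg (norm_nonneg s)]
    _ = _ := by simp [mul_pow]

theorem norm_Gamma_le_norm_Gamma_add_natCast (r : ℕ) {s : ℂ} (hs : 1 ≤ s.re ∨ 1 ≤ |s.im|) :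
    ‖Gamma s‖ ≤ ‖Gamma (s + r)‖ := by
  induction r with
  | zero => simp
  | succ r ih =>
    have hnorm : 1 ≤ ‖s + r‖ := by
      rcases hs with hs | hs
      · exact (by simpa using le_add_of_le_of_nonneg hs r.cast_nonneg : 1 ≤ (s + r).re).trans
          ((le_abs_self _).trans (abs_re_le_norm _))
      · exact (by simpa using hs : 1 ≤ |(s + r).im|).trans (abs_im_le_norm _)
    have hne : s + r ≠ 0 := norm_pos_iff.1 (one_pos.trans_le hnorm)
    rw [Nat.cast_succ, ← add_assoc, Gamma_add_one _ hne, norm_mul]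
    exact ih.trans (le_mul_of_one_le_left (norm_nonneg _) hnorm)

theorem inv_Gamma_eq_prod_mul_inv_Gamma_add_natCast (s : ℂ) (J : ℕ) :
    (Gamma s)⁻¹ = (∏ j ∈ Finset.range J, (s + j)) * (Gamma (s + J))⁻¹ := by
  induction J with
  | zero => simp
  | succ J ih =>
    rw [ih, one_div_Gamma_eq_self_mul_one_div_Gamma_add_one, Finset.prod_range_succ,
      Nat.cast_succ, mul_assoc, add_assoc]

theorem ExpPolyBound.mul_inv_Gamma_of_shift {D : Set ℂ} {h : ℂ → ℂ} {β : ℂ} {u v : ℝ} (J : ℕ)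
    (H : ExpPolyBound D (fun s => h s * (Gamma (s + β + J))⁻¹) u v) :
    ExpPolyBound D (fun s => h s * (Gamma (s + β))⁻¹) u v := by
  have hmul := (expPolyBound_prod_add_natCast D β J).mul H
  rw [zero_add, zero_add] at hmul
  refine hmul.of_norm_le fun s _ => le_of_eq ?_
  rw [inv_Gamma_eq_prod_mul_inv_Gamma_add_natCast (s + β) J, mul_left_comm]

section RightHalfPlane

variable {D : Set ℂ} {B : ℝ}

/- After shifting both arguments to the right by integers, which costs only polynomial factors, the
quotient is bounded by a value of the beta function. -/
theorem expPolyBound_Gamma_div_Gamma (hD : ∀ s ∈ D, -B ≤ s.re) (α β : ℂ)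
    (hα : ∀ s ∈ D, 1 ≤ (s + α).re ∨ 1 ≤ |(s + α).im|) :
    ExpPolyBound D (fun s => Gamma (s + α) * (Gamma (s + β))⁻¹) 0 0 := by
  obtain ⟨r, hr⟩ := exists_nat_ge (1 + B - α.re)
  obtain ⟨J, hJ⟩ := exists_nat_gt (α.re + r - β.re)
  set t : ℂ := β + J - α - r with ht
  have htre : 0 < t.re := by simp only [ht, sub_re, add_re, natCast_re]; linarith
  have hGt : 0 < ‖Gamma t‖ := norm_pos_iff.2 (Gamma_ne_zero_of_re_pos htre)
  refine .mul_inv_Gamma_of_shift J (.of_norm_le_exp (C := beta 1 t.re / ‖Gamma t‖)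
    (div_nonneg (beta_pos one_pos htre).le hGt.le) fun s hs => ?_)
  have hre : 1 ≤ (s + α + r).re := by
    simp only [add_re, natCast_re]; linarith [hD s hs]
  have hst : s + α + r + t = s + β + J := by rw [ht]; ring
  have hpos : 0 < ‖Gamma (s + β + J)‖ := by
    refine norm_pos_iff.2 (Gamma_ne_zero_of_re_pos ?_)
    rw [← hst, add_re]; linarith
  simp only [zero_mul, add_zero, Real.exp_zero, mul_one]
  rw [norm_mul, norm_inv, ← div_eq_mul_inv, div_le_div_iff₀ hpos hGt]
  calc ‖Gamma (s + α)‖ * ‖Gamma t‖ ≤ ‖Gamma (s + α + r)‖ * ‖Gamma t‖ := by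
        gcongr; exact norm_Gamma_le_norm_Gamma_add_natCast r (hα s hs)
    _ ≤ ‖Gamma (s + α + r + t)‖ * beta 1 t.re := norm_Gamma_mul_norm_Gamma_le one_pos hre htre
    _ = _ := by rw [hst, mul_comm]

theorem expPolyBound_inv_Gamma (hD : ∀ s ∈ D, -B ≤ s.re) (β : ℂ) (K : ℝ) :
    ExpPolyBound D (fun s => (Gamma (s + β))⁻¹) (-K) (π / 2) := by
  obtain ⟨J, hJ⟩ := exists_nat_ge (1 + B - β.re)
  obtain ⟨C, hC0, hC⟩ := exists_inv_Gamma_le_exp K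
  suffices hshift : ExpPolyBound D (fun s => 1 * (Gamma (s + β + J))⁻¹) (-K) (π / 2) by
    simpa only [one_mul] using hshift.mul_inv_Gamma_of_shift J
  refine .of_norm_le_exp (C := C * Real.exp (π / 2 * |β.im| + -K * (β.re + J))) (by positivity)
    fun s hs => ?_
  have hre : 1 ≤ (s + β + J).re := by
    simp only [add_re, natCast_re]; linarith [hD s hs]
  have him : |(s + β + J).im| ≤ |s.im| + |β.im| := by simpa using abs_add_le s.im β.im
  calc ‖1 * (Gamma (s + β + J))⁻¹‖
      ≤ Real.exp (π / 2 * |(s + β + J).im|) * (Real.Gamma (s + β + J).re)⁻¹ := by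
        rw [one_mul]; exact norm_inv_Gamma_le hre
    _ ≤ Real.exp (π / 2 * (|s.im| + |β.im|)) * (C * Real.exp (-K * (s + β + J).re)) := by
        gcongr; exact hC _ hre
    _ = _ := by
      rw [mul_left_comm, mul_assoc, ← Real.exp_add, ← Real.exp_add]
      simp only [add_re, natCast_re]
      ring_nf

end RightHalfPlane

theorem norm_sin_le_exp (s : ℂ) : ‖Complex.sin s‖ ≤ Real.exp |s.im| := by
  have hneg : ‖Complex.exp (-s * I)‖ ≤ Real.exp |s.im| := by
    rw [norm_exp]; simpa using le_abs_self s.im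
  have hpos : ‖Complex.exp (s * I)‖ ≤ Real.exp |s.im| := by
    rw [norm_exp]; simpa using neg_le_abs s.im
  rw [Complex.sin, norm_div, norm_mul, norm_I, mul_one, RCLike.norm_two, div_le_iff₀ two_pos]
  exact (norm_sub_le _ _).trans (by linarith)

theorem expPolyBound_sin (D : Set ℂ) (c : ℂ) :
    ExpPolyBound D (fun s => Complex.sin (π * (c - s))) 0 π := by
  refine .of_norm_le_exp (Real.exp_pos (π * |c.im|)).le fun s _ => ?_
  have him : |(π * (c - s)).im| ≤ π * |c.im| + π * |s.im| := by
    rw [im_ofReal_mul, abs_mul, abs_of_pos Real.pi_pos, ← mul_add, sub_im]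
    gcongr
    exact abs_sub _ _
  calc ‖Complex.sin (π * (c - s))‖ ≤ Real.exp |(π * (c - s)).im| := norm_sin_le_exp _
    _ ≤ Real.exp (π * |c.im| + π * |s.im|) := Real.exp_le_exp.2 him
    _ = _ := by rw [← Real.exp_add, zero_mul, zero_add]

theorem expPolyBound_exp (D : Set ℂ) (ω : ℂ) :
    ExpPolyBound D (fun s => Complex.exp (s * ω)) ω.re |ω.im| := by
  refine .of_norm_le_exp zero_le_one fun s _ => ?_
  rw [norm_exp, one_mul, Real.exp_le_exp, mul_re, mul_comm ω.re, ← abs_mul]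
  linarith [neg_le_abs (ω.im * s.im), congrArg abs (mul_comm ω.im s.im)]

/-! ### Growth of the integrand -/

theorem norm_sin_sq (s : ℂ) : ‖sin s‖ ^ 2 = Real.sin s.re ^ 2 + Real.sinh s.im ^ 2 := by
  have hre : (sin s).re = Real.sin s.re * Real.cosh s.im := by
    rw [sin_eq]; simp [← ofReal_sin, ← ofReal_cos, ← ofReal_cosh, ← ofReal_sinh]
  have him : (sin s).im = Real.cos s.re * Real.sinh s.im := by
    rw [sin_eq]; simp [← ofReal_sin, ← ofReal_cos, ← ofReal_cosh, ← ofReal_sinh]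
  rw [← normSq_eq_norm_sq, normSq_apply, hre, him]
  linear_combination Real.sin s.re ^ 2 * Real.cosh_sq s.im +
    Real.sinh s.im ^ 2 * Real.sin_sq_add_cos_sq s.re

theorem abs_sin_re_mul_exp_le_norm_sin (s : ℂ) :
    |Real.sin s.re| / 2 * Real.exp |s.im| ≤ ‖sin s‖ := by
  have hcosh : Real.exp |s.im| / 2 ≤ Real.cosh s.im := by
    rw [← Real.cosh_abs, Real.cosh_eq]
    linarith [Real.exp_pos (-|s.im|)]
  calc |Real.sin s.re| / 2 * Real.exp |s.im| = |Real.sin s.re| * (Real.exp |s.im| / 2) := by ring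
    _ ≤ |Real.sin s.re| * Real.cosh s.im := by gcongr
    _ ≤ ‖sin s‖ := by
      refine le_of_sq_le_sq ?_ (norm_nonneg _)
      rw [norm_sin_sq, mul_pow, sq_abs, Real.cosh_sq]
      nlinarith [Real.sin_sq_le_one s.re, sq_nonneg (Real.sinh s.im)]

theorem sinh_abs_im_le_norm_sin (s : ℂ) : Real.sinh |s.im| ≤ ‖sin s‖ := by
  refine le_of_sq_le_sq ?_ (norm_nonneg _)
  rw [norm_sin_sq, ← Real.abs_sinh, sq_abs]
  exact le_add_of_nonneg_left (sq_nonneg _)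

/-- On `D` the function `s ↦ sin (π (β - s))` is bounded below by a multiple of `exp (π |im s|)`,
its maximal order of growth. -/
def SinLowerBound (D : Set ℂ) (β : ℂ) : Prop :=
  ∃ c : ℝ, 0 < c ∧ ∀ s ∈ D, c * Real.exp (π * |s.im|) ≤ ‖sin (π * (β - s))‖

theorem abs_im_pi_mul (s : ℂ) : |(π * s).im| = π * |s.im| := by
  rw [im_ofReal_mul, abs_mul, abs_of_pos Real.pi_pos]

theorem exp_pi_mul_abs_im_le (β s : ℂ) :
    Real.exp (-(π * |β.im|)) * Real.exp (π * |s.im|) ≤ Real.exp |(π * (β - s)).im| := by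
  rw [← Real.exp_add, Real.exp_le_exp, abs_im_pi_mul, sub_im, abs_sub_comm, neg_add_eq_sub,
    ← mul_sub]
  exact mul_le_mul_of_nonneg_left (abs_sub_abs_le_abs_sub _ _) Real.pi_pos.le

theorem sinLowerBound_of_re {D : Set ℂ} {β : ℂ} {x : ℝ} (hx : ∀ j : ℤ, β.re - x ≠ j)
    (hD : ∀ s ∈ D, ∃ N : ℕ, s.re = x + N) : SinLowerBound D β := by
  have hsin : Real.sin (π * (β.re - x)) ≠ 0 := fun h => by
    obtain ⟨j, hj⟩ := Real.sin_eq_zero_iff.1 h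
    exact hx j (mul_left_cancel₀ Real.pi_pos.ne' (hj ▸ mul_comm _ _))
  refine ⟨|Real.sin (π * (β.re - x))| / 2 * Real.exp (-(π * |β.im|)), by positivity,
    fun s hs => ?_⟩
  obtain ⟨N, hN⟩ := hD s hs
  have hre : (π * (β - s) : ℂ).re = π * (β.re - x) - N * π := by
    rw [re_ofReal_mul, sub_re, hN]; ring
  have hperiod : |Real.sin (π * (β - s) : ℂ).re| = |Real.sin (π * (β.re - x))| := by
    rw [hre, Real.sin_sub_nat_mul_pi, abs_mul, abs_pow, abs_neg, abs_one, one_pow, one_mul]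
  rw [← hperiod, mul_assoc]
  refine le_trans ?_ (abs_sin_re_mul_exp_le_norm_sin _)
  gcongr
  exact exp_pi_mul_abs_im_le β s

theorem mul_exp_le_sinh {x y : ℝ} (h : x ≤ y) :
    (1 - Real.exp (-(2 * x))) / 2 * Real.exp y ≤ Real.sinh y := by
  have hexp : Real.exp (-y) = Real.exp (-(2 * y)) * Real.exp y := by
    rw [← Real.exp_add]; ring_nf
  have hle : Real.exp (-(2 * y)) ≤ Real.exp (-(2 * x)) := Real.exp_le_exp.2 (by linarith)
  rw [Real.sinh_eq, hexp]
  nlinarith [Real.exp_pos y]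

theorem sinLowerBound_of_im {D : Set ℂ} {β : ℂ} {η : ℝ} (hη : 0 < η)
    (hD : ∀ s ∈ D, η ≤ |β.im - s.im|) : SinLowerBound D β := by
  have hlt : Real.exp (-(2 * (π * η))) < 1 :=
    Real.exp_lt_one_iff.2 (neg_lt_zero.2 (by positivity))
  refine ⟨(1 - Real.exp (-(2 * (π * η)))) / 2 * Real.exp (-(π * |β.im|)),
    mul_pos (by linarith) (Real.exp_pos _), fun s hs => ?_⟩
  have hle : π * η ≤ |(π * (β - s)).im| := by
    rw [abs_im_pi_mul, sub_im]
    exact mul_le_mul_of_nonneg_left (hD s hs) Real.pi_pos.le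
  calc (1 - Real.exp (-(2 * (π * η)))) / 2 * Real.exp (-(π * |β.im|)) * Real.exp (π * |s.im|)
      ≤ (1 - Real.exp (-(2 * (π * η)))) / 2 * Real.exp |(π * (β - s)).im| := by
        rw [mul_assoc]
        exact mul_le_mul_of_nonneg_left (exp_pi_mul_abs_im_le β s) (by linarith)
    _ ≤ Real.sinh |(π * (β - s)).im| := mul_exp_le_sinh hle
    _ ≤ _ := sinh_abs_im_le_norm_sin _

theorem SinLowerBound.sin_ne_zero {D : Set ℂ} {β s : ℂ} (h : SinLowerBound D β) (hs : s ∈ D) :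
    sin (π * (β - s)) ≠ 0 := by
  obtain ⟨c, hc, hD⟩ := h
  exact norm_pos_iff.1 (lt_of_lt_of_le (by positivity) (hD s hs))

theorem SinLowerBound.expPolyBound_pi_div_sin {D : Set ℂ} {β : ℂ} (h : SinLowerBound D β) :
    ExpPolyBound D (fun s => π / sin (π * (β - s))) 0 (-π) := by
  obtain ⟨c, hc, hD⟩ := h
  refine .of_norm_le_exp (C := π / c) (by positivity) fun s hs => ?_
  rw [norm_div, norm_real, Real.norm_of_nonneg Real.pi_pos.le]
  calc π / ‖sin (π * (β - s))‖ ≤ π / (c * Real.exp (π * |s.im|)) :=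
        div_le_div_of_nonneg_left Real.pi_pos.le (by positivity) (hD s hs)
    _ = _ := by
      rw [zero_mul, zero_add, neg_mul, Real.exp_neg]
      field_simp

theorem Gamma_eq_pi_div_sin_mul_inv_Gamma {s : ℂ} (hs : sin (π * s) ≠ 0) :
    Gamma s = π / sin (π * s) * (Gamma (1 - s))⁻¹ := by
  have h := Gamma_mul_Gamma_one_sub s
  have hne : Gamma s * Gamma (1 - s) ≠ 0 := h ▸ div_ne_zero (by simp [Real.pi_ne_zero]) hs
  rw [← h, mul_inv_cancel_right₀ (right_ne_zero_of_mul hne)]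

theorem inv_Gamma_eq_sin_div_pi_mul_Gamma {s : ℂ} (hs : ∀ r : ℕ, 1 - s ≠ -r) :
    (Gamma s)⁻¹ = sin (π * s) / π * Gamma (1 - s) := by
  have hne : Gamma (1 - s) ≠ 0 := Gamma_ne_zero hs
  by_cases hsin : sin (π * s) = 0
  · have h := Gamma_mul_Gamma_one_sub s
    rw [hsin, div_zero] at h
    simp [(mul_eq_zero.1 h).resolve_right hne, hsin]
  · rw [Gamma_eq_pi_div_sin_mul_inv_Gamma hsin, mul_inv, inv_inv, inv_div]

/-- The exponential rate at which the integrand of `G^{M,N}_{P,Q}` at `z = exp ω` decays along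
vertical lines, `(M + N - (P + Q) / 2) π - |arg z|`. -/
def decayRate (M N P Q : ℕ) (ω : ℂ) : ℝ :=
  ((M : ℝ) + N - ((P : ℝ) + Q) / 2) * π - |ω.im|

section Integrand

variable {P Q : ℕ}

theorem prod_Gamma_sub_eq {ι : Type*} (S : Finset ι) (b : ι → ℂ) {s : ℂ}
    (hs : ∀ l ∈ S, sin (π * (b l - s)) ≠ 0) :
    ∏ l ∈ S, Gamma (b l - s) =
      (∏ l ∈ S, π / sin (π * (b l - s))) * ∏ l ∈ S, (Gamma (s + (1 - b l)))⁻¹ := by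
  rw [← Finset.prod_mul_distrib]
  refine Finset.prod_congr rfl fun l hl => ?_
  rw [Gamma_eq_pi_div_sin_mul_inv_Gamma (hs l hl)]
  ring_nf

theorem inv_prod_Gamma_sub_eq {ι : Type*} (S : Finset ι) (a : ι → ℂ) {s : ℂ}
    (hs : ∀ l ∈ S, ∀ r : ℕ, s + (1 - a l) ≠ -r) :
    (∏ l ∈ S, Gamma (a l - s))⁻¹ =
      (∏ l ∈ S, sin (π * (a l - s)) / π) * ∏ l ∈ S, Gamma (s + (1 - a l)) := by
  rw [← Finset.prod_inv_distrib, ← Finset.prod_mul_distrib]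
  refine Finset.prod_congr rfl fun l hl => ?_
  have hone : 1 - (a l - s) = s + (1 - a l) := by ring
  rw [inv_Gamma_eq_sin_div_pi_mul_Gamma (hone ▸ hs l hl), hone]

/- By the reflection formula every `Γ` can be given the argument `s + const`, so that the growth of
the integrand to the right is visible. -/
theorem integrand_eq_mul_prod_sin_mul_prod_Gamma (M N : ℕ) (a : Fin P → ℂ) (b : Fin Q → ℂ) (ω : ℂ)
    {s : ℂ} (ha : ∀ l, ∀ r : ℕ, s + (1 - a l) ≠ -r)
    (hb : ∀ l : Fin Q, l.val < M → sin (π * (b l - s)) ≠ 0) :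
    integrand M N a b ω s =
      exp (s * ω) * (∏ l : Fin Q with l.val < M, π / sin (π * (b l - s))) *
        (∏ l : Fin P with N ≤ l.val, sin (π * (a l - s)) / π) *
        ((∏ l, Gamma (s + (1 - a l))) * ∏ l, (Gamma (s + (1 - b l)))⁻¹) := by
  rw [integrand, div_eq_mul_inv, mul_inv,
    prod_Gamma_sub_eq _ b fun l hl => hb l (Finset.mem_filter.1 hl).2,
    inv_prod_Gamma_sub_eq _ a fun l _ => ha l,
    ← Finset.prod_filter_mul_prod_filter_not Finset.univ (fun l : Fin P => l.val < N),
    ← Finset.prod_filter_mul_prod_filter_not Finset.univ (fun l : Fin Q => l.val < M)]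
  simp only [not_lt, Finset.prod_inv_distrib, add_comm s]
  ring

variable {D : Set ℂ} {B : ℝ}

theorem expPolyBound_prod_Gamma_mul_prod_inv_Gamma (hPQ : P ≤ Q) (hD : ∀ s ∈ D, -B ≤ s.re)
    (α : Fin P → ℂ) (β : Fin Q → ℂ)
    (hα : ∀ s ∈ D, ∀ l, 1 ≤ (s + α l).re ∨ 1 ≤ |(s + α l).im|) (K : ℝ) :
    ExpPolyBound D (fun s => (∏ l, Gamma (s + α l)) * ∏ l, (Gamma (s + β l))⁻¹)
      (-(((Q : ℝ) - P) * K)) (((Q : ℝ) - P) * (π / 2)) := by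
  obtain ⟨d, rfl⟩ := Nat.exists_eq_add_of_le hPQ
  have hquot := ExpPolyBound.prod Finset.univ fun (l : Fin P) _ =>
    expPolyBound_Gamma_div_Gamma hD (α l) (β (Fin.castAdd d l)) (fun s hs => hα s hs l)
  have hinv := ExpPolyBound.prod Finset.univ fun (l : Fin d) _ =>
    expPolyBound_inv_Gamma hD (β (Fin.natAdd P l)) K
  convert hquot.mul hinv using 1
  · funext s
    rw [Fin.prod_univ_add, ← mul_assoc, Finset.prod_mul_distrib]
  all_goals simp

theorem expPolyBound_integrand {M N : ℕ} (hPQ : P ≤ Q) (hM : M ≤ Q) (hN : N ≤ P)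
    (a : Fin P → ℂ) (b : Fin Q → ℂ) (ω : ℂ) (hD : ∀ s ∈ D, -B ≤ s.re)
    (ha : ∀ s ∈ D, ∀ l, 1 ≤ (s + (1 - a l)).re ∨ 1 ≤ |(s + (1 - a l)).im|)
    (hb : ∀ l : Fin Q, l.val < M → SinLowerBound D (b l)) (K : ℝ) :
    ExpPolyBound D (integrand M N a b ω) (ω.re - ((Q : ℝ) - P) * K) (-decayRate M N P Q ω) := by
  have hcosec := ExpPolyBound.prod {l : Fin Q | l.val < M} fun l hl =>
    (hb l (Finset.mem_filter.1 hl).2).expPolyBound_pi_div_sin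
  have hsin := ExpPolyBound.prod {l : Fin P | N ≤ l.val} fun l _ =>
    (expPolyBound_sin D (a l)).mul (.const (π : ℂ)⁻¹)
  have hGamma := expPolyBound_prod_Gamma_mul_prod_inv_Gamma hPQ hD (1 - a ·) (1 - b ·) ha K
  have hcardM : Finset.card {l : Fin Q | l.val < M} = M := by
    rw [Fin.card_filter_val_lt, min_eq_right hM]
  have hcardN : ((Finset.univ.filter fun l : Fin P => N ≤ l.val).card : ℝ) = P - N := by
    have hcompl : (Finset.univ.filter fun l : Fin P => N ≤ l.val) =
        (Finset.univ.filter fun l : Fin P => l.val < N)ᶜ := by ext; simp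
    rw [← Nat.cast_sub hN, hcompl, Finset.card_compl, Fin.card_filter_val_lt, min_eq_right hN,
      Fintype.card_fin]
  have hmul := (((expPolyBound_exp D ω).mul hcosec).mul hsin).mul hGamma
  rw [hcardM, hcardN] at hmul
  convert hmul.of_norm_le (h' := integrand M N a b ω) fun s hs => le_of_eq ?_ using 1
  · ring
  · rw [decayRate]; ring
  · refine congrArg norm (integrand_eq_mul_prod_sin_mul_prod_Gamma M N a b ω (fun l r hr => ?_)
      fun l hl => (hb l hl).sin_ne_zero hs)
    have hl := ha s hs l
    rw [hr, neg_re, natCast_re, neg_im, natCast_im, neg_zero, abs_zero] at hl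
    rcases hl with hl | hl <;> linarith [(Nat.cast_nonneg r : (0 : ℝ) ≤ r)]

end Integrand

/-! ### Changes of argument and logarithms -/

theorem locallyIntegrable_deriv {γ : ℝ → ℂ} (hγ : LocallyLipschitz γ) :
    LocallyIntegrable (deriv γ) := by
  intro x
  obtain ⟨K, t, ht, hK⟩ := hγ x
  refine ⟨interior t ∩ Ioo (x - 1) (x + 1), inter_mem (interior_mem_nhds.2 ht)
    (Ioo_mem_nhds (by linarith) (by linarith)), ?_⟩
  refine Measure.integrableOn_of_bounded (M := K)
    ((measure_mono inter_subset_right).trans_lt (by simp)).ne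
    (measurable_deriv γ).aestronglyMeasurable ?_
  filter_upwards [ae_restrict_mem (isOpen_interior.measurableSet.inter measurableSet_Ioo)]
    with y hy
  exact norm_deriv_le_of_lipschitzOn (mem_interior_iff_mem_nhds.1 hy.1) hK

theorem intervalIntegrable_mul_deriv {γ f : ℝ → ℂ} (hγ : LocallyLipschitz γ) {a b : ℝ}
    (hf : ContinuousOn f (uIcc a b)) :
    IntervalIntegrable (fun t => f t * deriv γ t) volume a b :=
  IntervalIntegrable.continuousOn_mul
    ((locallyIntegrable_deriv hγ).integrableOn_isCompact isCompact_uIcc).intervalIntegrable hf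

namespace IsPiecewiseC1

variable {γ : ℝ → ℂ} {w : ℂ} {a b : ℝ}

theorem continuous (hγ : IsPiecewiseC1 γ) : Continuous γ := hγ.1.continuous

theorem integral_eq_sub (hγ : IsPiecewiseC1 γ) {f G : ℂ → ℂ}
    (hf : ContinuousOn (fun t => f (γ t)) (uIcc a b))
    (hG : ∀ t ∈ uIcc a b, HasDerivAt G (f (γ t)) (γ t)) :
    ∫ t in a..b, f (γ t) * deriv γ t = G (γ b) - G (γ a) := by
  obtain ⟨hlip, S, hS, hd⟩ := hγ
  refine integral_eq_of_hasDerivAt_off_countable (fun t => G (γ t)) _ hS.countable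
    (fun t ht => ?_) (fun t ht => ?_) (intervalIntegrable_mul_deriv hlip hf)
  · exact ((hG t ht).continuousAt.comp hlip.continuous.continuousAt).continuousWithinAt
  · exact (hG t (Ioo_subset_Icc_self ht.1)).comp t
      ((hd t ht.2).differentiableAt one_ne_zero).hasDerivAt

theorem intervalIntegrable_deriv_div_sub (hγ : IsPiecewiseC1 γ) (hw : ∀ t, γ t ≠ w) (a b : ℝ) :
    IntervalIntegrable (fun t => deriv γ t / (γ t - w)) volume a b := by
  have hcont : Continuous fun t => (γ t - w)⁻¹ :=
    (hγ.continuous.sub continuous_const).inv₀ fun t => sub_ne_zero.2 (hw t)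
  simpa only [div_eq_inv_mul] using intervalIntegrable_mul_deriv hγ.1 hcont.continuousOn

theorem re_integral_deriv_div_sub (hγ : IsPiecewiseC1 γ) (hw : ∀ t, γ t ≠ w) (a b : ℝ) :
    (∫ t in a..b, deriv γ t / (γ t - w)).re = Real.log ‖γ b - w‖ - Real.log ‖γ a - w‖ := by
  have hint := hγ.intervalIntegrable_deriv_div_sub hw a b
  have hne : ∀ t, γ t - w ≠ 0 := fun t => sub_ne_zero.2 (hw t)
  have hcont : Continuous fun t => Real.log ‖γ t - w‖ :=
    (hγ.continuous.sub continuous_const).norm.log fun t => norm_ne_zero_iff.2 (hne t)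
  have hre : (∫ t in a..b, deriv γ t / (γ t - w)).re = ∫ t in a..b, (deriv γ t / (γ t - w)).re :=
    (reCLM.intervalIntegral_comp_comm hint).symm
  obtain ⟨-, S, hS, hd⟩ := hγ
  rw [hre]
  refine integral_eq_of_hasDerivAt_off_countable (fun t => Real.log ‖γ t - w‖) _ hS.countable
    hcont.continuousOn (fun t ht => ?_) (intervalIntegrable_iff.2 (reCLM.integrable_comp hint.def'))
  -- `log` of the quotient is differentiable at `t` wherever `γ t - w` lies.
  have hlog : HasDerivAt (fun x => log ((γ x - w) / (γ t - w))) (deriv γ t / (γ t - w)) t := by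
    have hγt : HasDerivAt γ (deriv γ t) t :=
      ((hd t ht.2).differentiableAt one_ne_zero).hasDerivAt
    refine (((hγt.sub_const w).div_const (γ t - w)).clog_real (by simp [hne t])).congr_deriv ?_
    rw [div_self (hne t), div_one]
  have hlog_re : HasDerivAt (fun x => (log ((γ x - w) / (γ t - w))).re + Real.log ‖γ t - w‖)
      (deriv γ t / (γ t - w)).re t :=
    (reCLM.hasFDerivAt.comp_hasDerivAt t hlog).add_const _
  refine hlog_re.congr_of_eventuallyEq (Eventually.of_forall fun x => ?_)
  simp only [log_re, norm_div]
  rw [Real.log_div (norm_ne_zero_iff.2 (hne x)) (norm_ne_zero_iff.2 (hne t)), sub_add_cancel]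

theorem integral_deriv_div_sub_eq_log_sub_log (hγ : IsPiecewiseC1 γ)
    (h : ∀ t ∈ uIcc a b, γ t - w ∈ slitPlane) :
    ∫ t in a..b, deriv γ t / (γ t - w) = log (γ b - w) - log (γ a - w) := by
  have hcont : ContinuousOn (fun t => (γ t - w)⁻¹) (uIcc a b) :=
    (hγ.continuous.sub continuous_const).continuousOn.inv₀ fun t ht => slitPlane_ne_zero (h t ht)
  simpa only [div_eq_inv_mul] using hγ.integral_eq_sub (f := fun z => (z - w)⁻¹)
    (G := fun z => log (z - w)) hcont fun t ht => by
      simpa only [id, one_div] using ((hasDerivAt_id (γ t)).sub_const w).clog (h t ht)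

end IsPiecewiseC1

theorem tendsto_arg_add_mul {ζ : ℂ} (hζ : ζ ∈ slitPlane) (z : ℂ) :
    Tendsto (fun t : ℝ => arg (z + t * ζ)) atTop (𝓝 (arg ζ)) := by
  have hinv : Tendsto (fun t : ℝ => ((t⁻¹ : ℝ) : ℂ)) atTop (𝓝 ((0 : ℝ) : ℂ)) :=
    (continuous_ofReal.tendsto 0).comp tendsto_inv_atTop_zero
  have hscaled : Tendsto (fun t : ℝ => ((t⁻¹ : ℝ) : ℂ) * z + ζ) atTop (𝓝 ζ) := by
    simpa only [ofReal_zero, zero_mul, zero_add] using (hinv.mul_const z).add_const ζ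
  refine ((continuousAt_arg hζ).tendsto.comp hscaled).congr' ?_
  filter_upwards [eventually_gt_atTop 0] with t ht
  have ht₀ : (t : ℂ) ≠ 0 := ofReal_ne_zero.2 ht.ne'
  rw [Function.comp_apply, ← arg_real_mul (z + t * ζ) (inv_pos.2 ht)]
  congr 1
  push_cast
  field_simp

/-- The integral of `1 / (s - w)` along the part `|t| ≤ R` of `γ`, completed to a closed curve in
the plane slit to the left of `w`. -/
def logDefect (γ : ℝ → ℂ) (w : ℂ) (R : ℝ) : ℂ :=
  (∫ t in (-R)..R, deriv γ t / (γ t - w)) + log (γ (-R) - w) - log (γ R - w)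

theorem logDefect_eq_logDefect {γ : ℝ → ℂ} (hγ : IsPiecewiseC1 γ) {w : ℂ} (hw : ∀ t, γ t ≠ w)
    {R R' : ℝ} (hR : R ≤ R') (hstart : ∀ t ≤ -R, γ t - w ∈ slitPlane)
    (hend : ∀ t, R ≤ t → γ t - w ∈ slitPlane) :
    logDefect γ w R' = logDefect γ w R := by
  have hint := hγ.intervalIntegrable_deriv_div_sub hw
  have integral_start := hγ.integral_deriv_div_sub_eq_log_sub_log (w := w) (a := -R') (b := -R)
    (fun t ht => hstart t (by rw [uIcc_of_le (by linarith)] at ht; exact ht.2))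
  have integral_end := hγ.integral_deriv_div_sub_eq_log_sub_log (w := w) (a := R) (b := R')
    (fun t ht => hend t (by rw [uIcc_of_le hR] at ht; exact ht.1))
  rw [logDefect, logDefect,
    ← intervalIntegral.integral_add_adjacent_intervals (hint (-R') R) (hint R R'),
    ← intervalIntegral.integral_add_adjacent_intervals (hint (-R') (-R)) (hint (-R) R),
    integral_start, integral_end]
  ring

theorem ArgChange.logDefect_eq {γ : ℝ → ℂ} {w : ℂ} {θ : ℝ} (hθ : ArgChange γ w θ)
    (hγ : IsPiecewiseC1 γ) {T : ℝ} {z₁ z₂ ζ₁ ζ₂ : ℂ} (hζ₁ : ζ₁ ∈ slitPlane) (hζ₂ : ζ₂ ∈ slitPlane)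
    (hγ₁ : ∀ t, T ≤ t → γ (-t) = z₁ + t * ζ₁) (hγ₂ : ∀ t, T ≤ t → γ t = z₂ + t * ζ₂)
    {R : ℝ} (hstart : ∀ t ≤ -R, γ t - w ∈ slitPlane) (hend : ∀ t, R ≤ t → γ t - w ∈ slitPlane) :
    logDefect γ w R = I * (θ + arg ζ₁ - arg ζ₂ : ℝ) := by
  obtain ⟨hw, hlim⟩ := hθ
  have hre : (logDefect γ w R).re = 0 := by
    rw [logDefect, sub_re, add_re, hγ.re_integral_deriv_div_sub hw, log_re, log_re]
    ring
  have harg₁ : Tendsto (fun t : ℝ => arg (γ (-t) - w)) atTop (𝓝 (arg ζ₁)) := by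
    refine (tendsto_arg_add_mul hζ₁ (z₁ - w)).congr' ?_
    filter_upwards [eventually_ge_atTop T] with t ht
    rw [hγ₁ t ht, add_sub_right_comm]
  have harg₂ : Tendsto (fun t : ℝ => arg (γ t - w)) atTop (𝓝 (arg ζ₂)) := by
    refine (tendsto_arg_add_mul hζ₂ (z₂ - w)).congr' ?_
    filter_upwards [eventually_ge_atTop T] with t ht
    rw [hγ₂ t ht, add_sub_right_comm]
  have him : Tendsto (fun t : ℝ => (logDefect γ w t).im) atTop (𝓝 (θ + arg ζ₁ - arg ζ₂)) := by
    simpa only [logDefect, sub_im, add_im, log_im] using (hlim.add harg₁).sub harg₂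
  have himR : Tendsto (fun t : ℝ => (logDefect γ w t).im) atTop (𝓝 (logDefect γ w R).im) := by
    refine tendsto_const_nhds.congr' ?_
    filter_upwards [eventually_ge_atTop R] with t ht
    rw [logDefect_eq_logDefect hγ hw ht hstart hend]
  apply Complex.ext
  · simpa using hre
  · rw [tendsto_nhds_unique himR him]
    simp

/-- On `U`, the function `g` is the derivative of `G` plus the simple fractions `ρ w / (s - w)`,
`w ∈ W`. -/
structure HasResidues (g : ℂ → ℂ) (U : Set ℂ) (W : Finset ℂ) (ρ G : ℂ → ℂ) : Prop where
  continuousOn : ContinuousOn g (U \ W)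
  hasDerivAt : ∀ s ∈ U \ W, HasDerivAt G (g s - ∑ w ∈ W, ρ w / (s - w)) s

/-- The primitive of `g` obtained from the principal branches of the logarithms, when
`HasResidues g U W ρ G` for some `U`. -/
def slitPrimitive (W : Finset ℂ) (ρ G : ℂ → ℂ) (s : ℂ) : ℂ :=
  G s + ∑ w ∈ W, ρ w * log (s - w)

namespace HasResidues

variable {g : ℂ → ℂ} {U : Set ℂ} {W : Finset ℂ} {ρ G : ℂ → ℂ}

theorem continuousOn_sub (h : HasResidues g U W ρ G) :
    ContinuousOn (fun s => g s - ∑ w ∈ W, ρ w / (s - w)) (U \ W) := by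
  refine h.continuousOn.sub (continuousOn_finsetSum _ fun w hw => ?_)
  refine continuousOn_const.div (continuousOn_id.sub continuousOn_const) fun s hs h₀ => ?_
  exact hs.2 (sub_eq_zero.1 h₀ ▸ hw)

theorem hasDerivAt_slitPrimitive (h : HasResidues g U W ρ G) {s : ℂ} (hs : s ∈ U)
    (hW : ∀ w ∈ W, s - w ∈ slitPlane) : HasDerivAt (slitPrimitive W ρ G) (g s) s := by
  have hsW : s ∉ (W : Set ℂ) := fun hs' => slitPlane_ne_zero (hW s hs') (sub_self s)
  have hlog := HasDerivAt.fun_sum (u := W) (A := fun w s => ρ w * log (s - w)) fun w hw =>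
    (((hasDerivAt_id s).sub_const w).clog (hW w hw)).const_mul (ρ w)
  refine ((h.hasDerivAt s ⟨hs, hsW⟩).add hlog).congr_deriv ?_
  simp only [id, mul_one_div, sub_add_cancel]

theorem integral_curve (h : HasResidues g U W ρ G) {γ : ℝ → ℂ} (hγ : IsPiecewiseC1 γ)
    {R : ℝ} (hU : ∀ t ∈ uIcc (-R) R, γ t ∈ U) (hW : ∀ w ∈ W, ∀ t, γ t ≠ w) :
    ∫ t in (-R)..R, g (γ t) * deriv γ t =
      slitPrimitive W ρ G (γ R) - slitPrimitive W ρ G (γ (-R)) +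
        ∑ w ∈ W, ρ w * logDefect γ w R := by
  have hmem : ∀ t ∈ uIcc (-R) R, γ t ∈ U \ W := fun t ht => ⟨hU t ht, fun hw => hW _ hw t rfl⟩
  have hcont : ContinuousOn (fun t => g (γ t) - ∑ w ∈ W, ρ w / (γ t - w)) (uIcc (-R) R) :=
    h.continuousOn_sub.comp hγ.continuous.continuousOn hmem
  have hint : ∀ w ∈ W, IntervalIntegrable (fun t => ρ w * (deriv γ t / (γ t - w))) volume (-R) R :=
    fun w hw => (hγ.intervalIntegrable_deriv_div_sub (hW w hw) _ _).const_mul _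
  have regular_part : ∫ t in (-R)..R, (g (γ t) - ∑ w ∈ W, ρ w / (γ t - w)) * deriv γ t =
      G (γ R) - G (γ (-R)) :=
    hγ.integral_eq_sub (f := fun s => g s - ∑ w ∈ W, ρ w / (s - w)) hcont
      fun t ht => h.hasDerivAt _ (hmem t ht)
  have simple_fractions : ∫ t in (-R)..R, ∑ w ∈ W, ρ w * (deriv γ t / (γ t - w)) =
      ∑ w ∈ W, ρ w * ∫ t in (-R)..R, deriv γ t / (γ t - w) := by
    simp only [intervalIntegral.integral_finsetSum hint, intervalIntegral.integral_const_mul]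
  have decompose : ∀ t, g (γ t) * deriv γ t =
      (g (γ t) - ∑ w ∈ W, ρ w / (γ t - w)) * deriv γ t +
        ∑ w ∈ W, ρ w * (deriv γ t / (γ t - w)) := fun t => by
    simp only [sub_mul, Finset.sum_mul, mul_div_assoc', div_mul_eq_mul_div, sub_add_cancel]
  have hint_sum := IntervalIntegrable.sum W hint
  rw [Finset.sum_fn] at hint_sum
  simp only [decompose]
  rw [intervalIntegral.integral_add (intervalIntegrable_mul_deriv hγ.1 hcont) hint_sum,
    regular_part, simple_fractions]
  simp only [slitPrimitive, logDefect, mul_add, mul_sub, Finset.sum_add_distrib,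
    Finset.sum_sub_distrib]
  ring

theorem integral_segment (h : HasResidues g U W ρ G) (z ζ : ℂ) {x y : ℝ}
    (hU : ∀ t ∈ uIcc x y, z + t * ζ ∈ U)
    (hW : ∀ w ∈ W, ∀ t ∈ uIcc x y, z + t * ζ - w ∈ slitPlane) :
    ζ * ∫ t in x..y, g (z + t * ζ) =
      slitPrimitive W ρ G (z + y * ζ) - slitPrimitive W ρ G (z + x * ζ) := by
  have hmem : ∀ t ∈ uIcc x y, z + (t : ℂ) * ζ ∈ U \ W := fun t ht =>
    ⟨hU t ht, fun hw => slitPlane_ne_zero (hW _ hw t ht) (sub_self _)⟩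
  have hline : Continuous fun t : ℝ => z + (t : ℂ) * ζ := by fun_prop
  have hcont : ContinuousOn (fun t : ℝ => g (z + t * ζ)) (uIcc x y) :=
    h.continuousOn.comp hline.continuousOn hmem
  rw [← intervalIntegral.integral_const_mul]
  refine intervalIntegral.integral_eq_sub_of_hasDerivAt
    (f := fun t : ℝ => slitPrimitive W ρ G (z + t * ζ)) (fun t ht => ?_)
    (continuousOn_const.mul hcont).intervalIntegrable
  have hderiv : HasDerivAt (fun t : ℝ => z + (t : ℂ) * ζ) ζ t := by
    simpa using ((hasDerivAt_id t).ofReal_comp.mul_const ζ).const_add z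
  rw [mul_comm]
  exact (h.hasDerivAt_slitPrimitive (hU t ht) fun w hw => hW w hw t ht).comp t hderiv

theorem integral_vertical (h : HasResidues g U W ρ G) {γ : ℝ → ℂ} (hγ : IsPiecewiseC1 γ)
    {X R : ℝ} (hU : ∀ t ∈ uIcc (-R) R, γ t ∈ U) (hW : ∀ w ∈ W, ∀ t, γ t ≠ w)
    (hX : ∀ w ∈ W, w.re < X)
    {x₁ x₂ : ℝ} (hγ₁ : γ (-R) = x₁ + (-R : ℝ) * I) (hγ₂ : γ R = x₂ + R * I)
    (hR : ∀ w ∈ W, |w.im| < R) (hU' : ∀ s : ℂ, s.re ∈ uIcc x₁ X ∪ uIcc x₂ X → s ∈ U) :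
    (∫ t in (-R)..R, g (γ t) * deriv γ t) + (∫ x in x₂..X, g (x + R * I)) -
      I * (∫ y in (-R)..R, g (X + y * I)) -
      (∫ x in x₁..X, g (x + (-R : ℝ) * I)) = ∑ w ∈ W, ρ w * logDefect γ w R := by
  have integral_top := h.integral_segment (R * I) 1 (x := x₂) (y := X)
    (fun t ht => hU' _ (Or.inr (by simpa using ht)))
    (fun w hw t _ => Or.inr (by simpa using (sub_pos.2 (abs_lt.1 (hR w hw)).2).ne'))
  have integral_bottom := h.integral_segment ((-R : ℝ) * I) 1 (x := x₁) (y := X)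
    (fun t ht => hU' _ (Or.inl (by simpa using ht)))
    (fun w hw t _ => Or.inr (by simpa using (sub_neg.2 (abs_lt.1 (hR w hw)).1).ne))
  have integral_right := h.integral_segment (X : ℂ) I (x := -R) (y := R)
    (fun t _ => hU' _ (Or.inr (by simp)))
    (fun w hw t _ => Or.inl (by simpa using hX w hw))
  simp only [mul_one, one_mul, add_comm (_ * I)] at integral_top integral_bottom
  rw [integral_top, integral_bottom, integral_right, h.integral_curve hγ hU hW, hγ₁, hγ₂]
  ring

theorem integral_rightLoop (h : HasResidues g U W ρ G) {γ : ℝ → ℂ} (hγ : IsPiecewiseC1 γ)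
    {X : ℝ} (hU : ∀ t ∈ uIcc (-X) X, γ t ∈ U) (hW : ∀ w ∈ W, ∀ t, γ t ≠ w)
    (hX : ∀ w ∈ W, w.re < X)
    {y₁ y₂ : ℝ} (hγ₁ : γ (-X) = X + y₁ * I) (hγ₂ : γ X = X + y₂ * I)
    (hU' : ∀ s : ℂ, s.re = X → s ∈ U) :
    (∫ t in (-X)..X, g (γ t) * deriv γ t) -
      I * (∫ y in y₁..y₂, g (X + y * I)) = ∑ w ∈ W, ρ w * logDefect γ w X := by
  have integral_right := h.integral_segment (X : ℂ) I (x := y₁) (y := y₂)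
    (fun t _ => hU' _ (by simp))
    (fun w hw t _ => Or.inl (by simpa using hX w hw))
  rw [integral_right, h.integral_curve hγ hU hW, hγ₁, hγ₂]
  ring

end HasResidues

/-! ### Residues -/

/-- The function `F` has an isolated singularity with residue `r` at `w`: apart from the simple
fraction `r / (s - w)`, its principal part is the derivative of a function `Q` that is holomorphic
off `w`. -/
def HasResidueAt (F : ℂ → ℂ) (w r : ℂ) : Prop :=
  ∃ Q g : ℂ → ℂ, DifferentiableOn ℂ Q {w}ᶜ ∧ AnalyticAt ℂ g w ∧
    ∀ᶠ s in 𝓝[≠] w, F s = r / (s - w) + deriv Q s + g s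

theorem HasResidueAt.congr {F F' : ℂ → ℂ} {w r : ℂ} (h : HasResidueAt F w r)
    (hF : F' =ᶠ[𝓝[≠] w] F) : HasResidueAt F' w r := by
  obtain ⟨Q, g, hQ, hg, heq⟩ := h
  exact ⟨Q, g, hQ, hg, by filter_upwards [heq, hF] with s hs hF using hF.trans hs⟩

theorem HasResidueAt.add {F F' : ℂ → ℂ} {w r r' : ℂ} (h : HasResidueAt F w r)
    (h' : HasResidueAt F' w r') : HasResidueAt (fun s => F s + F' s) w (r + r') := by
  obtain ⟨Q, g, hQ, hg, heq⟩ := h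
  obtain ⟨Q', g', hQ', hg', heq'⟩ := h'
  refine ⟨fun s => Q s + Q' s, fun s => g s + g' s, hQ.add hQ', hg.add hg', ?_⟩
  filter_upwards [heq, heq', self_mem_nhdsWithin] with s hs hs' hsw
  have hnhds : {w}ᶜ ∈ 𝓝 s := isOpen_compl_singleton.mem_nhds hsw
  rw [hs, hs', deriv_fun_add (hQ.differentiableAt hnhds) (hQ'.differentiableAt hnhds)]
  ring

theorem hasResidueAt_of_analyticAt {F : ℂ → ℂ} {w : ℂ} (hF : AnalyticAt ℂ F w) :
    HasResidueAt F w 0 :=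
  ⟨0, F, differentiableOn_const 0, hF, Eventually.of_forall fun s => by simp⟩

theorem hasResidueAt_const_div_sub (c w : ℂ) : HasResidueAt (fun s => c / (s - w)) w c :=
  ⟨0, 0, differentiableOn_const 0, analyticAt_const, Eventually.of_forall fun s => by simp⟩

theorem hasResidueAt_const_div_sub_pow (c w : ℂ) (n : ℕ) :
    HasResidueAt (fun s => c / (s - w) ^ (n + 2)) w 0 := by
  have hderiv : ∀ s ∈ ({w} : Set ℂ)ᶜ, HasDerivAt (fun s => -(c / (n + 1)) * ((s - w) ^ (n + 1))⁻¹)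
      (c / (s - w) ^ (n + 2)) s := by
    intro s hs
    have hsw : s - w ≠ 0 := sub_ne_zero.2 hs
    have hn : (n : ℂ) + 1 ≠ 0 := Nat.cast_add_one_ne_zero n
    refine (((((hasDerivAt_id s).sub_const w).pow (n + 1)).inv
      (pow_ne_zero _ hsw)).const_mul (-(c / (n + 1)))).congr_deriv ?_
    simp only [id, Pi.pow_apply, Nat.add_sub_cancel, Nat.cast_add, Nat.cast_one]
    field_simp
    ring
  refine ⟨_, 0, fun s hs => (hderiv s hs).differentiableAt.differentiableWithinAt,
    analyticAt_const, ?_⟩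
  filter_upwards [self_mem_nhdsWithin] with s hs
  rw [(hderiv s hs).deriv]
  simp

theorem analyticAt_dslope {f : ℂ → ℂ} {w : ℂ} (hf : AnalyticAt ℂ f w) :
    AnalyticAt ℂ (dslope f w) w :=
  let ⟨_, hp⟩ := hf
  ⟨_, hp.has_fpower_series_dslope_fslope⟩

theorem hasResidueAt_div_sub {f : ℂ → ℂ} {w : ℂ} (hf : AnalyticAt ℂ f w) :
    HasResidueAt (fun s => f s / (s - w)) w (f w) := by
  refine (add_zero (f w)) ▸ ((hasResidueAt_const_div_sub (f w) w).add
    (hasResidueAt_of_analyticAt (analyticAt_dslope hf))).congr ?_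
  filter_upwards [self_mem_nhdsWithin] with s hs
  rw [dslope_of_ne _ hs, slope_def_field]
  ring

theorem exists_hasResidueAt_div_sub_pow {w : ℂ} (n : ℕ) :
    ∀ f : ℂ → ℂ, AnalyticAt ℂ f w → ∃ r, HasResidueAt (fun s => f s / (s - w) ^ n) w r := by
  induction n with
  | zero => exact fun f hf => ⟨0, by simpa using hasResidueAt_of_analyticAt hf⟩
  | succ n ih =>
    intro f hf
    rcases n with _ | n
    · exact ⟨f w, by simpa using hasResidueAt_div_sub hf⟩
    obtain ⟨r, hr⟩ := ih _ (analyticAt_dslope hf)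
    refine ⟨0 + r, ((hasResidueAt_const_div_sub_pow (f w) w n).add hr).congr ?_⟩
    filter_upwards [self_mem_nhdsWithin] with s hs
    have hsw : s - w ≠ 0 := sub_ne_zero.2 hs
    rw [dslope_of_ne _ hs, slope_def_field]
    field_simp
    ring

theorem exists_hasResidueAt_of_meromorphicAt {F : ℂ → ℂ} {w : ℂ} (hF : MeromorphicAt F w) :
    ∃ r, HasResidueAt F w r := by
  obtain ⟨n, hn⟩ := hF
  obtain ⟨r, hr⟩ := exists_hasResidueAt_div_sub_pow n _ hn
  refine ⟨r, hr.congr ?_⟩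
  filter_upwards [self_mem_nhdsWithin] with s hs
  rw [smul_eq_mul, mul_div_cancel_left₀ _ (pow_ne_zero n (sub_ne_zero.2 hs))]

theorem exists_analyticOnNhd_of_removable {F : ℂ → ℂ} {U : Set ℂ}
    (hF : ∀ s ∈ U, ∃ A, AnalyticAt ℂ A s ∧ F =ᶠ[𝓝[≠] s] A) :
    ∃ F' : ℂ → ℂ, AnalyticOnNhd ℂ F' U ∧ ∀ s ∈ U, AnalyticAt ℂ F s → F' s = F s := by
  have hmero : MeromorphicOn F U := fun s hs =>
    let ⟨_, hA, heq⟩ := hF s hs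
    hA.meromorphicAt.congr heq.symm
  refine ⟨toMeromorphicNFOn F U, fun s hs => ?_, fun s hs hFs => ?_⟩
  · obtain ⟨A, hA, heq⟩ := hF s hs
    refine (meromorphicNFOn_toMeromorphicNFOn F U hs).meromorphicOrderAt_nonneg_iff_analyticAt.1 ?_
    rw [meromorphicOrderAt_toMeromorphicNFOn hmero hs, meromorphicOrderAt_congr heq]
    exact hA.meromorphicOrderAt_nonneg
  · rw [toMeromorphicNFOn_eq_toMeromorphicNFAt hmero hs,
      toMeromorphicNFAt_eq_self.2 hFs.meromorphicNFAt]

theorem exists_hasResidues {g ρ : ℂ → ℂ} {U : Set ℂ} {W : Finset ℂ} (hU : IsOpen U)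
    (hconv : Convex ℝ U) (hg : ∀ s ∈ U \ W, AnalyticAt ℂ g s)
    (hρ : ∀ w ∈ W, HasResidueAt g w (ρ w)) : ∃ G, HasResidues g U W ρ G := by
  classical
  simp only [HasResidueAt] at hρ
  choose! Q h hQ hh heq using hρ
  have hQ_deriv : ∀ w ∈ W, ∀ s ≠ w, HasDerivAt (Q w) (deriv (Q w) s) s := fun w hw s hs =>
    ((hQ w hw).differentiableAt (isOpen_compl_singleton.mem_nhds hs)).hasDerivAt
  set P : ℂ → ℂ → ℂ := fun w s => ρ w / (s - w) + deriv (Q w) s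
  have hP : ∀ w ∈ W, ∀ s ≠ w, AnalyticAt ℂ (P w) s := fun w hw s hs =>
    (analyticAt_const.div (analyticAt_id.sub analyticAt_const) (sub_ne_zero.2 hs)).add
      ((hQ w hw).analyticAt (isOpen_compl_singleton.mem_nhds hs)).deriv
  have analyticAt_of_notMem : ∀ s ∈ U \ W, AnalyticAt ℂ (fun s => g s - ∑ w ∈ W, P w s) s :=
    fun s hs => (hg s hs).sub <| Finset.analyticAt_fun_sum W fun w hw =>
      hP w hw s fun h => hs.2 (h ▸ hw)
  have removable_of_mem : ∀ w ∈ W, ∃ A, AnalyticAt ℂ A w ∧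
      (fun s => g s - ∑ v ∈ W, P v s) =ᶠ[𝓝[≠] w] A := by
    intro w hw
    refine ⟨fun s => h w s - ∑ v ∈ W.erase w, P v s, (hh w hw).sub ?_, ?_⟩
    · exact Finset.analyticAt_fun_sum _ fun v hv =>
        hP v (Finset.mem_of_mem_erase hv) w (Finset.ne_of_mem_erase hv).symm
    · filter_upwards [heq w hw] with s hs
      rw [← Finset.add_sum_erase W _ hw, hs]
      ring
  obtain ⟨F, hF, hF_eq⟩ := exists_analyticOnNhd_of_removable (U := U) fun s hs => by
    by_cases hsW : s ∈ W
    · exact removable_of_mem s hsW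
    · exact ⟨_, analyticAt_of_notMem s ⟨hs, hsW⟩, EventuallyEq.rfl⟩
  obtain ⟨G, hG⟩ := hconv.exists_forall_hasDerivWithinAt hF.differentiableOn
  refine ⟨fun s => G s + ∑ w ∈ W, Q w s,
    fun s hs => (hg s hs).continuousAt.continuousWithinAt, fun s hs => ?_⟩
  have hsum := HasDerivAt.fun_sum fun w hw => hQ_deriv w hw s fun h => hs.2 (h ▸ hw)
  refine (((hG s hs.1).hasDerivAt (hU.mem_nhds hs.1)).add hsum).congr_deriv ?_
  rw [hF_eq s hs.1 (analyticAt_of_notMem s hs)]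
  simp only [P, Finset.sum_add_distrib]
  ring

/-! ### Decay and integrability -/

theorem exists_one_add_pow_le_exp (A : ℕ) {ε : ℝ} (hε : 0 < ε) :
    ∃ C : ℝ, 0 ≤ C ∧ ∀ x : ℝ, 0 ≤ x → (1 + x) ^ A ≤ C * Real.exp (ε * x) := by
  refine ⟨A.factorial * Real.exp ε / ε ^ A, by positivity, fun x hx => ?_⟩
  have h := Real.pow_div_factorial_le_exp (ε * (1 + x)) (by positivity) A
  rw [div_le_iff₀ (by positivity), mul_pow, mul_add, Real.exp_add, mul_one] at h
  rw [div_mul_eq_mul_div, le_div_iff₀ (by positivity)]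
  linarith

theorem ExpPolyBound.exists_norm_le_exp {D : Set ℂ} {h : ℂ → ℂ} {u v : ℝ}
    (H : ExpPolyBound D h u v) {ε : ℝ} (hε : 0 < ε) : ∃ C : ℝ, 0 ≤ C ∧ ∀ s ∈ D,
      ‖h s‖ ≤ C * Real.exp (u * s.re + v * |s.im| + ε * (|s.re| + |s.im|)) := by
  obtain ⟨C, A, hC, hbound⟩ := H
  obtain ⟨C', hC', hpow⟩ := exists_one_add_pow_le_exp A hε
  refine ⟨C * C', by positivity, fun s hs => ?_⟩
  calc ‖h s‖ ≤ C * (1 + ‖s‖) ^ A * Real.exp (u * s.re + v * |s.im|) := hbound s hs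
    _ ≤ C * (C' * Real.exp (ε * ‖s‖)) * Real.exp (u * s.re + v * |s.im|) := by
      gcongr
      exact hpow _ (norm_nonneg s)
    _ ≤ C * (C' * Real.exp (ε * (|s.re| + |s.im|))) * Real.exp (u * s.re + v * |s.im|) := by
      gcongr
      exact norm_le_abs_re_add_abs_im s
    _ = C * C' * Real.exp (u * s.re + v * |s.im| + ε * (|s.re| + |s.im|)) := by
      rw [Real.exp_add _ (ε * _)]
      ring

theorem integrable_of_norm_le_exp {E : Type*} [NormedAddCommGroup E] {f : ℝ → E}
    (hf : LocallyIntegrable f) {C₁ C₂ c₁ c₂ T₁ T₂ : ℝ} (hc₁ : 0 < c₁) (hc₂ : 0 < c₂)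
    (h₁ : ∀ t, T₁ ≤ t → ‖f (-t)‖ ≤ C₁ * Real.exp (-c₁ * t))
    (h₂ : ∀ t, T₂ ≤ t → ‖f t‖ ≤ C₂ * Real.exp (-c₂ * t)) : Integrable f := by
  refine hf.integrable_of_isBigO_atBot_atTop (g := fun t => Real.exp (c₁ * t))
    (g' := fun t => Real.exp (-c₂ * t)) (.of_bound C₁ ?_)
    ⟨Iic 0, Iic_mem_atBot 0, integrableOn_exp_mul_Iic hc₁ 0⟩ (.of_bound C₂ ?_)
    ⟨Ioi 0, Ioi_mem_atTop 0, integrableOn_exp_mul_Ioi (by linarith) 0⟩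
  · filter_upwards [eventually_le_atBot (-T₁)] with t ht
    have h := h₁ (-t) (by linarith)
    rwa [neg_neg, neg_mul_neg, ← Real.norm_of_nonneg (Real.exp_pos (c₁ * t)).le] at h
  · filter_upwards [eventually_ge_atTop T₂] with t ht
    have h := h₂ t ht
    rwa [← Real.norm_of_nonneg (Real.exp_pos (-c₂ * t)).le] at h

theorem integrable_exp_neg_mul_abs {c : ℝ} (hc : 0 < c) :
    Integrable fun t : ℝ => Real.exp (-c * |t|) := by
  refine integrable_of_norm_le_exp (C₁ := 1) (C₂ := 1) (T₁ := 0) (T₂ := 0)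
    (Continuous.locallyIntegrable (by fun_prop)) hc hc (fun t ht => ?_) (fun t ht => ?_) <;>
  simp [abs_of_nonneg ht]

theorem locallyIntegrable_mul_deriv {γ f : ℝ → ℂ} (hγ : LocallyLipschitz γ) (hf : Continuous f) :
    LocallyIntegrable fun t => f t * deriv γ t :=
  locallyIntegrableOn_univ.1 (((locallyIntegrable_deriv hγ).locallyIntegrableOn
    univ).continuousOn_mul hf.continuousOn isOpen_univ.isLocallyClosed)

theorem deriv_eq_of_eqOn_ray {γ : ℝ → ℂ} {T : ℝ} {z ζ : ℂ} (h : ∀ t, T ≤ t → γ t = z + t * ζ)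
    {t : ℝ} (ht : T < t) : deriv γ t = ζ := by
  have hray : HasDerivAt (fun x : ℝ => z + (x : ℂ) * ζ) ζ t := by
    simpa using ((hasDerivAt_id t).ofReal_comp.mul_const ζ).const_add z
  refine (hray.congr_of_eventuallyEq ?_).deriv
  filter_upwards [Ioi_mem_nhds ht] with x hx using h x (le_of_lt hx)

/-- Exponential decay of `g` along the ray from `z` in the direction `ζ`. -/
def DecaysAlong (g : ℂ → ℂ) (z ζ : ℂ) : Prop :=
  ∃ C c T : ℝ, 0 < c ∧ ∀ t : ℝ, T ≤ t → ‖g (z + t * ζ)‖ ≤ C * Real.exp (-c * t)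

theorem DecaysAlong.exists_norm_mul_deriv_le {g : ℂ → ℂ} {z ζ : ℂ} (hg : DecaysAlong g z ζ)
    {γ : ℝ → ℂ} {T : ℝ} (hγ : ∀ t, T ≤ t → γ t = z + t * ζ) :
    ∃ C c T' : ℝ, 0 < c ∧ ∀ t, T' ≤ t → ‖g (γ t) * deriv γ t‖ ≤ C * Real.exp (-c * t) := by
  obtain ⟨C, c, T', hc, hdecay⟩ := hg
  refine ⟨C * ‖ζ‖, c, max T' (T + 1), hc, fun t ht => ?_⟩
  have hT' : T' ≤ t := (le_max_left _ _).trans ht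
  have hT : T < t := by linarith [(le_max_right _ _).trans ht]
  rw [norm_mul, deriv_eq_of_eqOn_ray hγ hT, hγ t hT.le, mul_right_comm]
  gcongr
  exact hdecay t hT'

theorem IsPiecewiseC1.integrable_mul_deriv {g : ℂ → ℂ} {γ : ℝ → ℂ} (hγ : IsPiecewiseC1 γ)
    (hg : Continuous fun t => g (γ t)) {T : ℝ} {z₁ z₂ ζ₁ ζ₂ : ℂ}
    (hγ₁ : ∀ t, T ≤ t → γ (-t) = z₁ + t * ζ₁) (hγ₂ : ∀ t, T ≤ t → γ t = z₂ + t * ζ₂)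
    (hg₁ : DecaysAlong g z₁ ζ₁) (hg₂ : DecaysAlong g z₂ ζ₂) :
    Integrable fun t => g (γ t) * deriv γ t := by
  obtain ⟨C₁, c₁, T₁, hc₁, hdecay₁⟩ := hg₁.exists_norm_mul_deriv_le hγ₁
  obtain ⟨C₂, c₂, T₂, hc₂, hdecay₂⟩ := hg₂.exists_norm_mul_deriv_le hγ₂
  refine integrable_of_norm_le_exp (C₁ := C₁) (T₁ := T₁) (locallyIntegrable_mul_deriv hγ.1 hg)
    hc₁ hc₂ (fun t ht => ?_) hdecay₂
  have hle := hdecay₁ t ht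
  rwa [deriv_comp_neg, mul_neg, norm_neg] at hle

theorem abs_le_abs_add_abs_of_mem_uIcc {x y t : ℝ} (ht : t ∈ uIcc x y) : |t| ≤ |x| + |y| := by
  have hmax : |t| ≤ max |x| |y| := by
    rcases mem_uIcc.1 ht with h | h
    · exact abs_le_max_abs_abs h.1 h.2
    · exact max_comm |x| |y| ▸ abs_le_max_abs_abs h.1 h.2
  exact hmax.trans (max_le_add_of_nonneg (abs_nonneg x) (abs_nonneg y))

/-- `g` is of exponential type `v` in `|im s|` on the parts of large `|im s|` of right
half-planes. -/
def HighBound (g : ℂ → ℂ) (v : ℝ) : Prop :=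
  ∀ B : ℝ, ∃ Y u : ℝ, ExpPolyBound {s | -B ≤ s.re ∧ Y ≤ |s.im|} g u v

namespace HighBound

variable {g : ℂ → ℂ} {κ : ℝ}

theorem exists_norm_le (h : HighBound g (-κ)) (hκ : 0 < κ) (B : ℝ) : ∃ Y C : ℝ,
    ∀ s : ℂ, |s.re| ≤ B → Y ≤ |s.im| → ‖g s‖ ≤ C * Real.exp (-(κ / 2) * |s.im|) := by
  obtain ⟨Y, u, H⟩ := h B
  obtain ⟨C, hC, hbound⟩ := H.exists_norm_le_exp (half_pos hκ)
  refine ⟨Y, C * Real.exp ((|u| + κ / 2) * B), fun s hs hY => ?_⟩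
  refine (hbound s ⟨(abs_le.1 hs).1, hY⟩).trans ?_
  have hu : u * s.re ≤ |u| * B := (le_abs_self _).trans (by rw [abs_mul]; gcongr)
  have hκB : κ / 2 * |s.re| ≤ κ / 2 * B := by gcongr
  rw [mul_assoc, ← Real.exp_add]
  exact mul_le_mul_of_nonneg_left (Real.exp_le_exp.2 (by linarith)) hC

theorem decaysAlong {ζ : ℂ} (h : HighBound g (-κ)) (hκ : 0 < κ) (x : ℝ) (hζre : ζ.re = 0)
    (hζim : |ζ.im| = 1) : DecaysAlong g x ζ := by
  obtain ⟨Y, C, hbound⟩ := h.exists_norm_le hκ |x|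
  refine ⟨C, κ / 2, max Y 0, half_pos hκ, fun t ht => ?_⟩
  have hre : ((x : ℂ) + t * ζ).re = x := by simp [hζre]
  have him : |((x : ℂ) + t * ζ).im| = t := by
    simp [abs_mul, hζim, abs_of_nonneg ((le_max_right _ _).trans ht)]
  have hle := hbound (x + t * ζ) (by rw [hre]) (him.symm ▸ (le_max_left _ _).trans ht)
  rwa [him] at hle

theorem integrable_line (h : HighBound g (-κ)) (hκ : 0 < κ) {x : ℝ}
    (hg : Continuous fun y : ℝ => g (x + y * I)) : Integrable fun y : ℝ => g (x + y * I) := by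
  obtain ⟨C₁, c₁, T₁, hc₁, hdecay₁⟩ := h.decaysAlong hκ x (ζ := -I) (by simp) (by simp)
  obtain ⟨C₂, c₂, T₂, hc₂, hdecay₂⟩ := h.decaysAlong hκ x (ζ := I) (by simp) (by simp)
  refine integrable_of_norm_le_exp (C₁ := C₁) (T₁ := T₁) hg.locallyIntegrable hc₁ hc₂
    (fun t ht => ?_) hdecay₂
  simpa using hdecay₁ t ht

theorem tendsto_integral_horizontal (h : HighBound g (-κ)) (hκ : 0 < κ) (x y : ℝ) {R : ℝ → ℝ}
    (hR : Tendsto (fun r => |R r|) atTop atTop) :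
    Tendsto (fun r => ∫ t in x..y, g (t + R r * I)) atTop (𝓝 0) := by
  obtain ⟨Y, C, hbound⟩ := h.exists_norm_le hκ (|x| + |y|)
  have hexp : Tendsto (fun r => Real.exp (-(κ / 2) * |R r|)) atTop (𝓝 0) :=
    Real.tendsto_exp_atBot.comp (hR.const_mul_atTop_of_neg (by linarith))
  refine squeeze_zero_norm' ?_ (a := fun r => C * Real.exp (-(κ / 2) * |R r|) * |y - x|)
    (by simpa using (hexp.const_mul C).mul_const |y - x|)
  filter_upwards [hR.eventually_ge_atTop Y] with r hr
  refine intervalIntegral.norm_integral_le_of_norm_le_const fun t ht => ?_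
  have hle := hbound (t + R r * I)
    (by simpa using abs_le_abs_add_abs_of_mem_uIcc (uIoc_subset_uIcc ht)) (by simpa using hr)
  simpa using hle

end HighBound

theorem IsVertical.integrable {g : ℂ → ℂ} {γ : ℝ → ℂ} {κ : ℝ} (hv : IsVertical γ)
    (hγ : IsPiecewiseC1 γ) (hg : Continuous fun t => g (γ t)) (h : HighBound g (-κ)) (hκ : 0 < κ) :
    Integrable fun t => g (γ t) * deriv γ t := by
  obtain ⟨x₁, x₂, T, h₁, h₂⟩ := hv
  refine hγ.integrable_mul_deriv hg (z₁ := x₁) (ζ₁ := -I) (fun t ht => ?_) h₂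
    (h.decaysAlong hκ x₁ (by simp) (by simp)) (h.decaysAlong hκ x₂ (by simp) (by simp))
  rw [h₁ (-t) (by linarith)]
  push_cast
  ring

/-- `g` decays on the lines `re s = x + N` for large natural numbers `N`: by the factor `exp (u N)`
if `u < 0`, and exponentially on each of the lines if `v < 0`. -/
def LineBound (g : ℂ → ℂ) (x u v : ℝ) : Prop :=
  ∃ N₀ : ℕ, ExpPolyBound {s | ∃ N : ℕ, N₀ ≤ N ∧ s.re = x + N} g u v

theorem tendsto_add_natCast_atTop (x : ℝ) : Tendsto (fun N : ℕ => x + (N : ℝ)) atTop atTop :=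
  tendsto_atTop_add_const_left _ x tendsto_natCast_atTop_atTop

theorem tendsto_exp_mul_add_natCast {u : ℝ} (hu : u < 0) (x : ℝ) :
    Tendsto (fun N : ℕ => Real.exp (u * (x + N))) atTop (𝓝 0) :=
  Real.tendsto_exp_atBot.comp ((tendsto_add_natCast_atTop x).const_mul_atTop_of_neg hu)

namespace LineBound

variable {g : ℂ → ℂ} {x u v : ℝ}

theorem exists_norm_le (h : LineBound g x u v) (hu : u < 0) {ε : ℝ} (hε : 0 < ε) :
    ∃ C : ℝ, 0 ≤ C ∧ ∃ c < 0, ∀ᶠ N : ℕ in atTop, ∀ y : ℝ,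
      ‖g ((x + N : ℝ) + y * I)‖ ≤ C * Real.exp (c * (x + N)) * Real.exp ((v + ε) * |y|) := by
  obtain ⟨N₀, H⟩ := h
  obtain ⟨C, hC, hbound⟩ := H.exists_norm_le_exp (ε := min (-u / 2) ε) (lt_min (by linarith) hε)
  refine ⟨C, hC, u / 2, by linarith, ?_⟩
  filter_upwards [eventually_ge_atTop N₀, (tendsto_add_natCast_atTop x).eventually_ge_atTop 0]
    with N hN hxN y
  have hre : (((x + N : ℝ) : ℂ) + y * I).re = x + N := by simp
  have him : (((x + N : ℝ) : ℂ) + y * I).im = y := by simp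
  refine (hbound _ ⟨N, hN, hre⟩).trans ?_
  rw [hre, him, abs_of_nonneg hxN, mul_assoc, ← Real.exp_add]
  have hle₁ : min (-u / 2) ε * (x + N) ≤ -u / 2 * (x + N) :=
    mul_le_mul_of_nonneg_right (min_le_left _ _) hxN
  have hle₂ : min (-u / 2) ε * |y| ≤ ε * |y| :=
    mul_le_mul_of_nonneg_right (min_le_right _ _) (abs_nonneg y)
  exact mul_le_mul_of_nonneg_left (Real.exp_le_exp.2 (by linarith)) hC

theorem tendsto_integral_line {κ : ℝ} (h : LineBound g x u (-κ)) (hu : u < 0) (hκ : 0 < κ) :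
    Tendsto (fun N : ℕ => ∫ y : ℝ, g ((x + N : ℝ) + y * I)) atTop (𝓝 0) := by
  obtain ⟨C, -, c, hc, hbound⟩ := h.exists_norm_le hu (half_pos hκ)
  set E := ∫ y : ℝ, Real.exp (-(κ / 2) * |y|)
  refine squeeze_zero_norm' ?_ (a := fun N : ℕ => C * Real.exp (c * (x + N)) * E)
    (by simpa using ((tendsto_exp_mul_add_natCast hc x).const_mul C).mul_const E)
  filter_upwards [hbound] with N hN
  rw [← integral_const_mul]
  refine norm_integral_le_of_norm_le ((integrable_exp_neg_mul_abs (half_pos hκ)).const_mul _)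
    (.of_forall fun y => ?_)
  rw [show -(κ / 2) = -κ + κ / 2 by ring]
  exact hN y

theorem tendsto_integral_segment (h : LineBound g x u v) (hu : u < 0) (y₁ y₂ : ℝ) :
    Tendsto (fun N : ℕ => ∫ y in y₁..y₂, g ((x + N : ℝ) + y * I)) atTop (𝓝 0) := by
  obtain ⟨C, hC, c, hc, hbound⟩ := h.exists_norm_le hu one_pos
  set E := Real.exp (|v + 1| * (|y₁| + |y₂|))
  refine squeeze_zero_norm' ?_
    (a := fun N : ℕ => C * Real.exp (c * (x + N)) * E * |y₂ - y₁|)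
    (by simpa using
      (((tendsto_exp_mul_add_natCast hc x).const_mul C).mul_const E).mul_const (|y₂ - y₁|))
  filter_upwards [hbound] with N hN
  refine intervalIntegral.norm_integral_le_of_norm_le_const fun y hy => (hN y).trans ?_
  have hy' := abs_le_abs_add_abs_of_mem_uIcc (uIoc_subset_uIcc hy)
  gcongr
  exact Real.exp_le_exp.2 (by gcongr; exact le_abs_self (v + 1))

end LineBound

/-! ### Closing contours to the right -/

/-- The vertical strip `-B < re s < X`. -/
def strip (B X : ℝ) : Set ℂ :=
  re ⁻¹' Ioo (-B) X

/-- `g` is analytic outside `Z`, with residue `ρ w` at each point `w` of `Z`, and the points of `Z`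
do not accumulate in vertical strips. -/
structure HasPoles (g : ℂ → ℂ) (Z : Set ℂ) (ρ : ℂ → ℂ) : Prop where
  analyticAt : ∀ s ∉ Z, AnalyticAt ℂ g s
  hasResidueAt : ∀ w ∈ Z, HasResidueAt g w (ρ w)
  finite : ∀ B X : ℝ, (Z ∩ strip B X).Finite

namespace HasPoles

variable {g ρ : ℂ → ℂ} {Z : Set ℂ} {B X : ℝ}

/-- The points of `Z` in a vertical strip. -/
def poles (h : HasPoles g Z ρ) (B X : ℝ) : Finset ℂ :=
  (h.finite B X).toFinset

theorem mem_poles (h : HasPoles g Z ρ) {w : ℂ} :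
    w ∈ h.poles B X ↔ w ∈ Z ∧ -B < w.re ∧ w.re < X := by
  simp only [poles, Finite.mem_toFinset, strip, mem_inter_iff, mem_preimage, mem_Ioo]

theorem continuous_comp (h : HasPoles g Z ρ) {γ : ℝ → ℂ} (hγ : Continuous γ)
    (hZ : ∀ w ∈ Z, ∀ t, γ t ≠ w) : Continuous fun t => g (γ t) :=
  continuous_iff_continuousAt.2 fun t =>
    (h.analyticAt (γ t) fun hmem => hZ _ hmem t rfl).continuousAt.comp hγ.continuousAt

theorem exists_hasResidues (h : HasPoles g Z ρ) (B : ℝ) (hX : ∀ w ∈ Z, w.re ≠ X) :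
    ∃ X' > X, ∃ G, HasResidues g (strip B X') (h.poles B X) ρ G := by
  have hgap : ∀ᶠ X' in 𝓝[>] X, ∀ w ∈ Z ∩ strip B (X + 1), X < w.re → X' < w.re :=
    (h.finite B (X + 1)).eventually_all.2 fun w _ =>
      eventually_imp_distrib_left.2 fun hw => mem_nhdsWithin_of_mem_nhds (Iio_mem_nhds hw)
  obtain ⟨X', hX', hXX', hX'1⟩ := (hgap.and (Ioo_mem_nhdsGT (lt_add_one X))).exists
  refine ⟨X', hXX', MeijerG.exists_hasResidues (isOpen_Ioo.preimage continuous_re)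
    ((convex_Ioo _ _).is_linear_preimage reLm.isLinear) (fun s hs => h.analyticAt s fun hmem => ?_)
    fun w hw => h.hasResidueAt w (h.mem_poles.1 hw).1⟩
  obtain ⟨⟨hBs, hsX'⟩, hs⟩ := hs
  rcases (hX s hmem).lt_or_gt with hlt | hgt
  · exact hs (h.mem_poles.2 ⟨hmem, hBs, hlt⟩)
  · exact (hX' s ⟨hmem, hBs, hsX'.trans hX'1⟩ hgt).not_gt hsX'

theorem sum_poles_sub_sum_poles (h : HasPoles g Z ρ) {φ₁ φ₂ : ℂ → ℝ} {C : Finset ℂ}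
    (hC : C ⊆ h.poles B X) (hφ : ∀ w ∈ Z, w ∉ C → φ₁ w = φ₂ w) :
    ∑ w ∈ h.poles B X, ρ w * (I * φ₁ w) - ∑ w ∈ h.poles B X, ρ w * (I * φ₂ w) =
      ∑ w ∈ C, ρ w * (I * (φ₁ w - φ₂ w)) := by
  rw [← Finset.sum_sub_distrib, ← Finset.sum_subset hC fun w hw hwC => by
    rw [hφ w (h.mem_poles.1 hw).1 hwC, sub_self]]
  exact Finset.sum_congr rfl fun w _ => by ring

theorem subset_poles (h : HasPoles g Z ρ) {C : Finset ℂ} (hC : ↑C ⊆ Z)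
    (hB : ∀ w ∈ C, -B < w.re) (hX : ∀ w ∈ C, w.re < X) : C ⊆ h.poles B X :=
  fun w hw => h.mem_poles.2 ⟨hC hw, hB w hw, hX w hw⟩

end HasPoles

/-- `γ` goes from `-i∞` to `i∞`, and `arg (γ t - w)` changes by `φ w + π` for all `w` in `Z`: thus
`φ w` is `0` for a point to the left of `γ` and `-2π` for a point to the right. -/
structure IsVerticalContour (γ : ℝ → ℂ) (Z : Set ℂ) (φ : ℂ → ℝ) : Prop where
  isPiecewiseC1 : IsPiecewiseC1 γ
  isVertical : IsVertical γ
  argChange : ∀ w ∈ Z, ArgChange γ w (φ w + π)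

/-- `γ` is a loop from and to `+∞`, and `arg (γ t - w)` changes by `φ w` for all `w` in `Z`: thus
`φ w` is `0` for a point outside the loop and `-2π` for a point that is encircled once in the
negative sense. -/
structure IsLoopContour (γ : ℝ → ℂ) (Z : Set ℂ) (φ : ℂ → ℝ) : Prop where
  isPiecewiseC1 : IsPiecewiseC1 γ
  isRightLoop : IsRightLoop γ
  argChange : ∀ w ∈ Z, ArgChange γ w (φ w)

theorem ArgChange.logDefect_eq_of_vertical {γ : ℝ → ℂ} {w : ℂ} {θ x₁ x₂ T R : ℝ}
    (hθ : ArgChange γ w (θ + π)) (hγ : IsPiecewiseC1 γ) (h₁ : ∀ t, t ≤ -T → γ t = x₁ + t * I)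
    (h₂ : ∀ t, T ≤ t → γ t = x₂ + t * I) (hT : T ≤ R) (hw : |w.im| < R) :
    logDefect γ w R = I * θ := by
  obtain ⟨hw₁, hw₂⟩ := abs_lt.1 hw
  rw [hθ.logDefect_eq hγ (T := T) (z₁ := x₁) (z₂ := x₂) (ζ₁ := -I) (ζ₂ := I) (.inr (by simp))
    (.inr (by simp)) (fun t ht => ?_) h₂ (fun t ht => .inr ?_) (fun t ht => .inr ?_),
    arg_I, arg_neg_I]
  · congr 2
    ring
  · rw [h₁ (-t) (by linarith)]
    push_cast
    ring
  · rw [h₁ t (by linarith)]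
    simp only [sub_im, add_im, ofReal_im, mul_im, ofReal_re, I_im, I_re]
    linarith
  · rw [h₂ t (by linarith)]
    simp only [sub_im, add_im, ofReal_im, mul_im, ofReal_re, I_im, I_re]
    linarith

theorem ArgChange.logDefect_eq_of_rightLoop {γ : ℝ → ℂ} {w : ℂ} {θ y₁ y₂ T X : ℝ}
    (hθ : ArgChange γ w θ) (hγ : IsPiecewiseC1 γ) (h₁ : ∀ t : ℝ, t ≤ -T → γ t = -t + y₁ * I)
    (h₂ : ∀ t : ℝ, T ≤ t → γ t = t + y₂ * I) (hT : T ≤ X) (hw : w.re < X) :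
    logDefect γ w X = I * θ := by
  rw [hθ.logDefect_eq hγ (T := T) (z₁ := y₁ * I) (z₂ := y₂ * I) (ζ₁ := 1) (ζ₂ := 1)
    one_mem_slitPlane one_mem_slitPlane (fun t ht => ?_) (fun t ht => ?_) (fun t ht => .inl ?_)
    (fun t ht => .inl ?_), add_sub_cancel_right]
  · rw [h₁ (-t) (by linarith)]
    push_cast
    ring
  · rw [h₂ t ht]
    ring
  · rw [h₁ t (by linarith)]
    simp only [sub_re, add_re, neg_re, ofReal_re, re_ofReal_mul, I_re]
    linarith
  · rw [h₂ t (by linarith)]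
    simp only [sub_re, add_re, ofReal_re, re_ofReal_mul, I_re]
    linarith

theorem eventually_forall_neg_lt {f : ℝ → ℝ} (hf : Continuous f) {c₁ c₂ T : ℝ}
    (h₁ : ∀ t, t ≤ -T → c₁ ≤ f t) (h₂ : ∀ t, T ≤ t → c₂ ≤ f t) :
    ∀ᶠ B in atTop, ∀ t, -B < f t := by
  obtain ⟨M, hM⟩ := (isCompact_Icc (a := -T) (b := T)).bddBelow_image hf.continuousOn
  filter_upwards [eventually_gt_atTop (-c₁), eventually_gt_atTop (-c₂), eventually_gt_atTop (-M)]
    with B hc₁ hc₂ hBM t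
  rcases le_total t (-T) with ht | ht
  · linarith [h₁ t ht]
  rcases le_total T t with ht' | ht'
  · linarith [h₂ t ht']
  · linarith [hM (mem_image_of_mem f ⟨ht, ht'⟩)]

theorem IsVertical.eventually_neg_lt_re {γ : ℝ → ℂ} (hv : IsVertical γ) (hγ : Continuous γ) :
    ∀ᶠ B in atTop, ∀ t, -B < (γ t).re := by
  obtain ⟨x₁, x₂, T, h₁, h₂⟩ := hv
  exact eventually_forall_neg_lt (T := T) (continuous_re.comp hγ)
    (fun t ht => (by simp [h₁ t ht] : x₁ ≤ _)) fun t ht => (by simp [h₂ t ht] : x₂ ≤ _)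

theorem IsVertical.eventually_re_le {γ : ℝ → ℂ} (hv : IsVertical γ) (hγ : Continuous γ) :
    ∀ᶠ X in atTop, ∀ t, (γ t).re ≤ X := by
  obtain ⟨x₁, x₂, T, h₁, h₂⟩ := hv
  have h := eventually_forall_neg_lt (T := T) (continuous_re.comp hγ).neg
    (fun t ht => (by simp [h₁ t ht] : -x₁ ≤ _)) fun t ht => (by simp [h₂ t ht] : -x₂ ≤ _)
  exact h.mono fun X hX t => (neg_lt_neg_iff.1 (hX t)).le

theorem IsRightLoop.eventually_neg_lt_re {γ : ℝ → ℂ} (hr : IsRightLoop γ) (hγ : Continuous γ) :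
    ∀ᶠ B in atTop, ∀ t, -B < (γ t).re := by
  obtain ⟨y₁, y₂, T, h₁, h₂⟩ := hr
  refine eventually_forall_neg_lt (T := T) (c₁ := T) (c₂ := T) (continuous_re.comp hγ)
    (fun t ht => ?_) fun t ht => ?_
  · simpa [h₁ t ht] using le_neg_of_le_neg ht
  · simpa [h₂ t ht] using ht

theorem IsRightLoop.eventually_re_le {γ : ℝ → ℂ} (hr : IsRightLoop γ) (hγ : Continuous γ) :
    ∀ᶠ X in atTop, ∀ t ∈ uIcc (-X) X, (γ t).re ≤ X := by
  obtain ⟨y₁, y₂, T, h₁, h₂⟩ := hr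
  obtain ⟨M, hM⟩ := (isCompact_Icc (a := -T) (b := T)).bddAbove_image
    (continuous_re.comp hγ).continuousOn
  filter_upwards [eventually_ge_atTop M, eventually_ge_atTop 0] with X hXM hX t ht
  rw [uIcc_of_le (by linarith)] at ht
  rcases le_total t (-T) with htT | htT
  · simpa [h₁ t htT] using neg_le.1 ht.1
  rcases le_total T t with htT' | htT'
  · simpa [h₂ t htT'] using ht.2
  · exact (hM (mem_image_of_mem _ ⟨htT, htT'⟩)).trans hXM

namespace HasPoles

variable {g ρ : ℂ → ℂ} {γ γ₁ γ₂ : ℝ → ℂ} {Z : Set ℂ} {φ φ₁ φ₂ : ℂ → ℝ} {B X κ x u v : ℝ}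

theorem continuous_line (h : HasPoles g Z ρ) (hX : ∀ w ∈ Z, w.re ≠ X) :
    Continuous fun y : ℝ => g (X + y * I) :=
  h.continuous_comp (by fun_prop) fun w hw y hy => hX w hw (by simp [← hy])

theorem integral_vertical_sub_integral_line (h : HasPoles g Z ρ) (hb : HighBound g (-κ))
    (hκ : 0 < κ) (hγ : IsVerticalContour γ Z φ) (hX : ∀ w ∈ Z, w.re ≠ X)
    (hγB : ∀ t, -B < (γ t).re) (hγX : ∀ t, (γ t).re ≤ X) :
    (∫ t, g (γ t) * deriv γ t) - I * (∫ y : ℝ, g (X + y * I)) =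
      ∑ w ∈ h.poles B X, ρ w * (I * φ w) := by
  have hint := hγ.isVertical.integrable hγ.isPiecewiseC1 (h.continuous_comp
    hγ.isPiecewiseC1.continuous fun w hw => (hγ.argChange w hw).1) hb hκ
  obtain ⟨X', hXX', G, hG⟩ := h.exists_hasResidues B hX
  obtain ⟨x₁, x₂, T, h₁, h₂⟩ := hγ.isVertical
  have hlim₁ := intervalIntegral_tendsto_integral hint tendsto_neg_atTop_atBot tendsto_id
  have hlim₂ := hb.tendsto_integral_horizontal hκ x₂ X tendsto_abs_atTop_atTop
  have hlim₃ := (intervalIntegral_tendsto_integral (hb.integrable_line hκ (h.continuous_line hX))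
    tendsto_neg_atTop_atBot tendsto_id).const_mul I
  have hlim₄ := hb.tendsto_integral_horizontal hκ x₁ X
    (tendsto_abs_atBot_atTop.comp tendsto_neg_atTop_atBot)
  have hlim := ((hlim₁.add hlim₂).sub hlim₃).sub hlim₄
  rw [add_zero, sub_zero] at hlim
  refine tendsto_nhds_unique hlim (tendsto_const_nhds.congr' ?_)
  filter_upwards [eventually_ge_atTop T,
    (h.poles B X).eventually_all.2 fun w _ => eventually_gt_atTop |w.im|] with R hRT hR
  have hstart := h₁ (-R) (by linarith)
  have hend := h₂ R hRT
  have hx₁ : x₁ ∈ Ioc (-B) X := by simpa [hstart] using And.intro (hγB (-R)) (hγX (-R))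
  have hx₂ : x₂ ∈ Ioc (-B) X := by simpa [hend] using And.intro (hγB R) (hγX R)
  refine Eq.trans (Finset.sum_congr rfl fun w hw => ?_) (hG.integral_vertical hγ.isPiecewiseC1
    (X := X) (R := R) (fun t _ => ⟨hγB t, (hγX t).trans_lt hXX'⟩)
    (fun w hw => (hγ.argChange w (h.mem_poles.1 hw).1).1) (fun w hw => (h.mem_poles.1 hw).2.2)
    hstart hend hR fun s hs => ?_).symm
  · rw [(hγ.argChange w (h.mem_poles.1 hw).1).logDefect_eq_of_vertical hγ.isPiecewiseC1 h₁ h₂ hRT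
      (hR w hw)]
  · rw [uIcc_of_le hx₁.2, uIcc_of_le hx₂.2] at hs
    rcases hs with hs | hs
    · exact ⟨hx₁.1.trans_le hs.1, hs.2.trans_lt hXX'⟩
    · exact ⟨hx₂.1.trans_le hs.1, hs.2.trans_lt hXX'⟩

theorem integral_rightLoop_sub_integral_segment (h : HasPoles g Z ρ) (hγ : IsPiecewiseC1 γ)
    (hφ : ∀ w ∈ Z, ArgChange γ w (φ w)) {y₁ y₂ T : ℝ}
    (h₁ : ∀ t : ℝ, t ≤ -T → γ t = -t + y₁ * I) (h₂ : ∀ t : ℝ, T ≤ t → γ t = t + y₂ * I)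
    (hT : T ≤ X) (hX : ∀ w ∈ Z, w.re ≠ X) (hγB : ∀ t, -B < (γ t).re)
    (hγX : ∀ t ∈ uIcc (-X) X, (γ t).re ≤ X) :
    (∫ t in (-X)..X, g (γ t) * deriv γ t) - I * (∫ y in y₁..y₂, g (X + y * I)) =
      ∑ w ∈ h.poles B X, ρ w * (I * φ w) := by
  obtain ⟨X', hXX', G, hG⟩ := h.exists_hasResidues B hX
  have hBX : -B < X := by simpa [h₂ X hT] using hγB X
  rw [hG.integral_rightLoop hγ (fun t ht => ⟨hγB t, (hγX t ht).trans_lt hXX'⟩)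
    (fun w hw => (hφ w (h.mem_poles.1 hw).1).1) (fun w hw => (h.mem_poles.1 hw).2.2)
    (by rw [h₁ (-X) (by linarith), ofReal_neg, neg_neg]) (h₂ X hT)
    fun s hs => ⟨hs ▸ hBX, hs ▸ hXX'⟩]
  refine Finset.sum_congr rfl fun w hw => ?_
  obtain ⟨hwZ, -, hwX⟩ := h.mem_poles.1 hw
  rw [(hφ w hwZ).logDefect_eq_of_rightLoop hγ h₁ h₂ hT hwX]

theorem tendsto_sum_poles_of_vertical (h : HasPoles g Z ρ) (hb : HighBound g (-κ)) (hκ : 0 < κ)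
    (hl : LineBound g x u (-κ)) (hu : u < 0)
    (hx : ∀ᶠ N : ℕ in atTop, ∀ w ∈ Z, w.re ≠ x + N) (hγ : IsVerticalContour γ Z φ)
    (hγB : ∀ t, -B < (γ t).re) :
    Tendsto (fun N : ℕ => ∑ w ∈ h.poles B (x + N), ρ w * (I * φ w)) atTop
      (𝓝 (∫ t, g (γ t) * deriv γ t)) := by
  have hlim := ((hl.tendsto_integral_line hu hκ).const_mul I).const_sub (∫ t, g (γ t) * deriv γ t)
  rw [mul_zero, sub_zero] at hlim
  refine hlim.congr' ?_
  filter_upwards [hx, (tendsto_add_natCast_atTop x).eventually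
    (hγ.isVertical.eventually_re_le hγ.isPiecewiseC1.continuous)] with N hxN hγX
  exact h.integral_vertical_sub_integral_line hb hκ hγ hxN hγB hγX

theorem tendsto_sum_poles_of_rightLoop (h : HasPoles g Z ρ) (hl : LineBound g x u v) (hu : u < 0)
    (hx : ∀ᶠ N : ℕ in atTop, ∀ w ∈ Z, w.re ≠ x + N) (hγ : IsLoopContour γ Z φ)
    (hint : Integrable fun t => g (γ t) * deriv γ t) (hγB : ∀ t, -B < (γ t).re) :
    Tendsto (fun N : ℕ => ∑ w ∈ h.poles B (x + N), ρ w * (I * φ w)) atTop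
      (𝓝 (∫ t, g (γ t) * deriv γ t)) := by
  have hX := tendsto_add_natCast_atTop x
  have hγX := hγ.isRightLoop.eventually_re_le hγ.isPiecewiseC1.continuous
  obtain ⟨y₁, y₂, T, h₁, h₂⟩ := hγ.isRightLoop
  have hlim := (intervalIntegral_tendsto_integral hint (tendsto_neg_atTop_atBot.comp hX) hX).sub
    ((hl.tendsto_integral_segment hu y₁ y₂).const_mul I)
  rw [mul_zero, sub_zero] at hlim
  refine hlim.congr' ?_
  filter_upwards [hx, hX.eventually hγX, hX.eventually_ge_atTop T] with N hxN hγXN hTN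
  exact h.integral_rightLoop_sub_integral_segment hγ.isPiecewiseC1 hγ.argChange h₁ h₂ hTN hxN hγB
    hγXN

end HasPoles

/-- A contour along which the integral of `g`, of exponential type `-κ` in `|im s|`, can be compared
with sums of residues of `g` to its right. A loop requires the decay of `g` on lines `re s = x + N`
further to the right. -/
structure IsClosable (g : ℂ → ℂ) (x κ : ℝ) (γ : ℝ → ℂ) (Z : Set ℂ) (φ : ℂ → ℝ) : Prop where
  integrable : Integrable fun t => g (γ t) * deriv γ t
  kind : (0 < κ ∧ IsVerticalContour γ Z φ) ∨
    ((∃ u < 0, LineBound g x u (-κ)) ∧ IsLoopContour γ Z φ)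

namespace IsClosable

variable {g ρ : ℂ → ℂ} {γ γ₁ γ₂ : ℝ → ℂ} {Z : Set ℂ} {φ φ₁ φ₂ : ℂ → ℝ} {B κ x u : ℝ}

theorem eventually_neg_lt_re (hγ : IsClosable g x κ γ Z φ) :
    ∀ᶠ B in atTop, ∀ t, -B < (γ t).re := by
  rcases hγ.kind with ⟨-, hv⟩ | ⟨-, hr⟩
  · exact hv.isVertical.eventually_neg_lt_re hv.isPiecewiseC1.continuous
  · exact hr.isRightLoop.eventually_neg_lt_re hr.isPiecewiseC1.continuous

theorem tendsto_sum_poles (hγ : IsClosable g x κ γ Z φ) (h : HasPoles g Z ρ)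
    (hb : HighBound g (-κ)) (hl : LineBound g x u (-κ)) (hu : u < 0)
    (hx : ∀ᶠ N : ℕ in atTop, ∀ w ∈ Z, w.re ≠ x + N) (hγB : ∀ t, -B < (γ t).re) :
    Tendsto (fun N : ℕ => ∑ w ∈ h.poles B (x + N), ρ w * (I * φ w)) atTop
      (𝓝 (∫ t, g (γ t) * deriv γ t)) := by
  rcases hγ.kind with ⟨hκ, hv⟩ | ⟨-, hr⟩
  · exact h.tendsto_sum_poles_of_vertical hb hκ hl hu hx hv hγB
  · exact h.tendsto_sum_poles_of_rightLoop hl hu hx hr hγ.integrable hγB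

theorem integral_sub_integral (hγ₁ : IsClosable g x κ γ₁ Z φ₁) (hγ₂ : IsClosable g x κ γ₂ Z φ₂)
    (h : HasPoles g Z ρ) (hb : HighBound g (-κ)) (hx : ∀ᶠ N : ℕ in atTop, ∀ w ∈ Z, w.re ≠ x + N)
    {C : Finset ℂ} (hC : ↑C ⊆ Z) (hφ : ∀ w ∈ Z, w ∉ C → φ₁ w = φ₂ w) :
    (∫ t, g (γ₁ t) * deriv γ₁ t) - ∫ t, g (γ₂ t) * deriv γ₂ t =
      ∑ w ∈ C, ρ w * (I * (φ₁ w - φ₂ w)) := by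
  have hX := tendsto_add_natCast_atTop x
  obtain ⟨B, hγB₁, hγB₂, hCB⟩ := (hγ₁.eventually_neg_lt_re.and (hγ₂.eventually_neg_lt_re.and
    (C.eventually_all.2 fun w _ => eventually_gt_atTop (-w.re)))).exists
  have hsub : ∀ᶠ N : ℕ in atTop, C ⊆ h.poles B (x + N) := by
    filter_upwards [C.eventually_all.2 fun w _ => hX.eventually_gt_atTop w.re] with N hN
    exact h.subset_poles hC (fun w hw => neg_lt.1 (hCB w hw)) hN
  by_cases hl : ∃ u < 0, LineBound g x u (-κ)
  · obtain ⟨u, hu, hl⟩ := hl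
    refine tendsto_nhds_unique ((hγ₁.tendsto_sum_poles h hb hl hu hx hγB₁).sub
      (hγ₂.tendsto_sum_poles h hb hl hu hx hγB₂)) (tendsto_const_nhds.congr' ?_)
    filter_upwards [hsub] with N hN
    exact (h.sum_poles_sub_sum_poles hN hφ).symm
  · obtain ⟨hκ, hv₁⟩ := hγ₁.kind.resolve_right fun hr => hl hr.1
    obtain ⟨-, hv₂⟩ := hγ₂.kind.resolve_right fun hr => hl hr.1
    obtain ⟨N, hN, hxN, hγX₁, hγX₂⟩ := (hsub.and (hx.and
      ((hX.eventually (hv₁.isVertical.eventually_re_le hv₁.isPiecewiseC1.continuous)).and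
      (hX.eventually (hv₂.isVertical.eventually_re_le hv₂.isPiecewiseC1.continuous))))).exists
    rw [← h.sum_poles_sub_sum_poles hN hφ,
      ← h.integral_vertical_sub_integral_line hb hκ hv₁ hxN hγB₁ hγX₁,
      ← h.integral_vertical_sub_integral_line hb hκ hv₂ hxN hγB₂ hγX₂, sub_sub_sub_cancel_right]

end IsClosable

/-! ### Regularity and decay of the integrand -/

section IntegrandEstimates

variable {P Q M N : ℕ} {a : Fin P → ℂ} {b : Fin Q → ℂ} {ω : ℂ} {γ : ℝ → ℂ} {x : ℝ}

theorem analyticAt_inv_Gamma_comp {f : ℂ → ℂ} {s : ℂ} (hf : AnalyticAt ℂ f s) :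
    AnalyticAt ℂ (fun s => (Gamma (f s))⁻¹) s :=
  (differentiable_one_div_Gamma.analyticAt (f s)).comp hf

theorem analyticAt_Gamma_comp {f : ℂ → ℂ} {s : ℂ} (hf : AnalyticAt ℂ f s)
    (hs : ∀ r : ℕ, f s ≠ -r) : AnalyticAt ℂ (fun s => Gamma (f s)) s := by
  simpa only [inv_inv] using (analyticAt_inv_Gamma_comp hf).fun_inv (inv_ne_zero (Gamma_ne_zero hs))

theorem meromorphicAt_Gamma_comp {f : ℂ → ℂ} {s : ℂ} (hf : AnalyticAt ℂ f s) :
    MeromorphicAt (fun s => Gamma (f s)) s := by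
  simpa only [inv_inv] using (analyticAt_inv_Gamma_comp hf).meromorphicAt.fun_inv

/-- The Mellin-Barnes integrand with arbitrary sets of indices for the four products. -/
def gammaQuotient (S S' : Finset (Fin Q)) (T T' : Finset (Fin P)) (a : Fin P → ℂ) (b : Fin Q → ℂ)
    (ω s : ℂ) : ℂ :=
  exp (s * ω) *
    (((∏ l ∈ S, Gamma (b l - s)) * (∏ l ∈ T, Gamma (1 - a l + s))) /
      ((∏ l ∈ S', Gamma (1 - b l + s)) * (∏ l ∈ T', Gamma (a l - s))))

section gammaQuotient

variable {S S' : Finset (Fin Q)} {T T' : Finset (Fin P)} {s : ℂ}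

theorem analyticAt_gammaQuotient (hS : ∀ l ∈ S, ∀ r : ℕ, s ≠ b l + r)
    (hT : ∀ l ∈ T, ∀ r : ℕ, s ≠ a l - 1 - r) :
    AnalyticAt ℂ (gammaQuotient S S' T T' a b ω) s := by
  unfold gammaQuotient
  simp only [div_eq_mul_inv, mul_inv, ← Finset.prod_inv_distrib]
  refine (by fun_prop : AnalyticAt ℂ _ s).mul (.mul (.mul ?_ ?_) (.mul ?_ ?_)) <;>
    refine Finset.analyticAt_fun_prod _ fun l hl => ?_
  · exact analyticAt_Gamma_comp (by fun_prop) fun r h => hS l hl r (by linear_combination -h)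
  · exact analyticAt_Gamma_comp (by fun_prop) fun r h => hT l hl r (by linear_combination h)
  · exact analyticAt_inv_Gamma_comp (by fun_prop)
  · exact analyticAt_inv_Gamma_comp (by fun_prop)

theorem meromorphicAt_gammaQuotient : MeromorphicAt (gammaQuotient S S' T T' a b ω) s := by
  refine AnalyticAt.meromorphicAt (by fun_prop) |>.mul (.div (.mul ?_ ?_) (.mul ?_ ?_)) <;>
    exact MeromorphicAt.fun_prod fun l _ => meromorphicAt_Gamma_comp (by fun_prop)

end gammaQuotient

theorem continuous_integrand_comp (hγ : Continuous γ)
    (hl : ∀ w ∈ leftPoles N a, ∀ t, γ t ≠ w) (hr : ∀ w ∈ rightPoles M b, ∀ t, γ t ≠ w) :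
    Continuous fun t => integrand M N a b ω (γ t) := by
  refine continuous_iff_continuousAt.2 fun t => ContinuousAt.comp (g := integrand M N a b ω)
    (analyticAt_gammaQuotient (fun l hlM r => ?_) fun l hlN r => ?_).continuousAt hγ.continuousAt
  · exact hr _ ⟨l, (Finset.mem_filter.1 hlM).2, r, rfl⟩ t
  · exact hl _ ⟨l, (Finset.mem_filter.1 hlN).2, r, rfl⟩ t

theorem highBound_integrand (hPQ : P ≤ Q) (hM : M ≤ Q) (hN : N ≤ P) (a : Fin P → ℂ)
    (b : Fin Q → ℂ) (ω : ℂ) : HighBound (integrand M N a b ω) (-decayRate M N P Q ω) := by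
  intro B
  obtain ⟨Y, hYa, hYb⟩ := ((eventually_all.2 fun l => eventually_ge_atTop (1 + |(a l).im|)).and
    (eventually_all.2 fun l => eventually_ge_atTop (1 + |(b l).im|))).exists
  refine ⟨Y, _, expPolyBound_integrand hPQ hM hN a b ω (fun s hs => hs.1)
    (fun s hs l => Or.inr ?_) (fun l _ => sinLowerBound_of_im one_pos fun s hs => ?_) 0⟩
  · have himag : (s + (1 - a l)).im = s.im - (a l).im := by simp [sub_eq_add_neg]
    rw [himag]
    linarith [hYa l, hs.2, abs_sub_abs_le_abs_sub s.im (a l).im]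
  · rw [abs_sub_comm]
    linarith [hYb l, hs.2, abs_sub_abs_le_abs_sub s.im (b l).im]

theorem exists_sub_mul_neg {x : ℝ} (hPQ : P ≤ Q) (h : P < Q ∨ x < 0) :
    ∃ K : ℝ, x - ((Q : ℝ) - P) * K < 0 := by
  rcases hPQ.eq_or_lt with rfl | hlt
  · exact ⟨0, by simpa using h⟩
  · have hQP : (0 : ℝ) < (Q : ℝ) - P := sub_pos.2 (by exact_mod_cast hlt)
    refine ⟨(x + 1) / ((Q : ℝ) - P), ?_⟩
    rw [mul_div_cancel₀ _ hQP.ne']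
    linarith

theorem exists_lineBound_integrand (hPQ : P ≤ Q) (hM : M ≤ Q) (hN : N ≤ P)
    (hω : P < Q ∨ ω.re < 0) (a : Fin P → ℂ) (hx : ∀ l, ∀ j : ℤ, (b l).re - x ≠ j) :
    ∃ u < 0, LineBound (integrand M N a b ω) x u (-decayRate M N P Q ω) := by
  obtain ⟨K, hK⟩ := exists_sub_mul_neg hPQ hω
  obtain ⟨N₀, hxN₀, haN₀⟩ := (((tendsto_add_natCast_atTop x).eventually_ge_atTop 0).and
    (eventually_all.2 fun l =>
      (tendsto_add_natCast_atTop x).eventually_ge_atTop (a l).re)).exists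
  have hle : ∀ s ∈ {s : ℂ | ∃ N : ℕ, N₀ ≤ N ∧ s.re = x + N}, x + N₀ ≤ s.re := by
    rintro s ⟨N, hN, hs⟩
    rw [hs]
    gcongr
  refine ⟨_, hK, N₀, expPolyBound_integrand hPQ hM hN a b ω (B := 0)
    (fun s hs => by linarith [hle s hs]) (fun s hs l => Or.inl ?_)
    (fun l _ => sinLowerBound_of_re (hx l) ?_) K⟩
  · simp only [add_re, sub_re, one_re]
    linarith [hle s hs, haN₀ l]
  · rintro s ⟨N, -, hs⟩
    exact ⟨N, hs⟩

theorem ExpPolyBound.decaysAlong {g : ℂ → ℂ} {T y u v : ℝ}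
    (H : ExpPolyBound {s | T ≤ s.re ∧ s.im = y} g u v) (hu : u < 0) :
    DecaysAlong g (y * I) 1 := by
  obtain ⟨C, -, hC⟩ := H.exists_norm_le_exp (ε := -u / 2) (by linarith)
  refine ⟨C * Real.exp (v * |y| - u / 2 * |y|), -u / 2, max T 0, by linarith, fun t ht => ?_⟩
  have hre : (y * I + t * 1 : ℂ).re = t := by simp
  have him : (y * I + t * 1 : ℂ).im = y := by simp
  refine (hC _ ⟨by rw [hre]; exact (le_max_left T 0).trans ht, him⟩).trans_eq ?_
  rw [hre, him, abs_of_nonneg ((le_max_right T 0).trans ht), mul_assoc, ← Real.exp_add]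
  ring_nf

theorem decaysAlong_integrand (hPQ : P ≤ Q) (hM : M ≤ Q) (hN : N ≤ P) (hω : P < Q ∨ ω.re < 0)
    (a : Fin P → ℂ) {y : ℝ} (hy : ∀ l : Fin Q, l.val < M → (b l).im ≠ y) :
    DecaysAlong (integrand M N a b ω) (y * I) 1 := by
  obtain ⟨K, hK⟩ := exists_sub_mul_neg hPQ hω
  obtain ⟨T, haT, hT⟩ :=
    ((eventually_all.2 fun l => eventually_ge_atTop (a l).re).and (eventually_ge_atTop 0)).exists
  refine (expPolyBound_integrand (D := {s | T ≤ s.re ∧ s.im = y}) hPQ hM hN a b ω (B := 0)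
    (fun s hs => by linarith [hs.1]) (fun s hs l => Or.inl ?_)
    (fun l hl => sinLowerBound_of_im (abs_pos.2 (sub_ne_zero.2 (hy l hl))) fun s hs => ?_)
    K).decaysAlong hK
  · simp only [add_re, sub_re, one_re]
    linarith [haT l, hs.1]
  · rw [hs.2]

end IntegrandEstimates

/-! ### Contours of the Meijer function -/

section Contours

variable {P Q M N : ℕ} {a : Fin P → ℂ} {b : Fin Q → ℂ} {ω : ℂ} {γ : ℝ → ℂ} {x : ℝ}

/-- The parameters for which no left loops occur among the integration paths. -/
def ClosesRight (P Q : ℕ) (ω : ℂ) : Prop :=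
  P ≤ Q ∧ (P = Q → ω.re ≤ 0)

theorem closesRight_or_closesRight_neg (P Q : ℕ) (ω : ℂ) :
    ClosesRight P Q ω ∨ ClosesRight Q P (-ω) := by
  simp only [ClosesRight, neg_re, Left.neg_nonpos_iff]
  rcases lt_trichotomy P Q with h | rfl | h
  · exact Or.inl ⟨h.le, fun h' => absurd h' h.ne⟩
  · exact (le_total ω.re 0).imp (fun h => ⟨le_rfl, fun _ => h⟩) fun h => ⟨le_rfl, fun _ => h⟩
  · exact Or.inr ⟨h.le, fun h' => absurd h' h.ne⟩

/-- The change of argument around `w` along a right loop that encircles in the negative sense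
exactly the points outside `L`. -/
def loopAngle (L : Set ℂ) : ℂ → ℝ :=
  Lᶜ.indicator fun _ => -(2 * π)

theorem loopAngle_of_mem {L : Set ℂ} {w : ℂ} (hw : w ∈ L) : loopAngle L w = 0 :=
  indicator_of_notMem (not_not_intro hw) _

theorem loopAngle_of_notMem {L : Set ℂ} {w : ℂ} (hw : w ∉ L) : loopAngle L w = -(2 * π) :=
  indicator_of_mem hw _

namespace IsContour

theorem ne_of_mem_leftPoles (h : IsContour M N a b ω γ) {w : ℂ} (hw : w ∈ leftPoles N a) (t : ℝ) :
    γ t ≠ w := by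
  rcases h.2 with ⟨-, -, -, hl, -⟩ | ⟨-, -, hl, -⟩ | ⟨-, -, hl, -⟩ <;> exact (hl w hw).1 t

theorem ne_of_mem_rightPoles (h : IsContour M N a b ω γ) {w : ℂ} (hw : w ∈ rightPoles M b)
    (t : ℝ) : γ t ≠ w := by
  rcases h.2 with ⟨-, -, -, -, hr⟩ | ⟨-, -, -, hr⟩ | ⟨-, -, -, hr⟩ <;> exact (hr w hw).1 t

theorem notMem_leftPoles (h : IsContour M N a b ω γ) (t : ℝ) : γ t ∉ leftPoles N a := fun ht =>
  h.ne_of_mem_leftPoles ht t rfl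

theorem notMem_rightPoles (h : IsContour M N a b ω γ) (t : ℝ) : γ t ∉ rightPoles M b := fun ht =>
  h.ne_of_mem_rightPoles ht t rfl

theorem continuous_integrand (h : IsContour M N a b ω γ) :
    Continuous fun t => integrand M N a b ω (γ t) :=
  continuous_integrand_comp h.1.continuous (fun _ => h.ne_of_mem_leftPoles)
    fun _ => h.ne_of_mem_rightPoles

theorem vertical_or_rightLoop (h : IsContour M N a b ω γ) (hω : ClosesRight P Q ω) :
    (IsVertical γ ∧ 0 < decayRate M N P Q ω ∧ (∀ w ∈ leftPoles N a, ArgChange γ w π) ∧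
      ∀ w ∈ rightPoles M b, ArgChange γ w (-π)) ∨
    (IsRightLoop γ ∧ (P < Q ∨ ω.re < 0) ∧ (∀ w ∈ leftPoles N a, ArgChange γ w 0) ∧
      ∀ w ∈ rightPoles M b, ArgChange γ w (-(2 * π))) := by
  rcases h.2 with ⟨hv, -, him, hl, hr⟩ | ⟨hγ, hPQ, hl, hr⟩ | ⟨-, hPQ | ⟨hQP, -, hnorm⟩, -⟩
  · exact Or.inl ⟨hv, sub_pos.2 him, hl, hr⟩
  · rw [norm_exp, Real.exp_lt_one_iff] at hPQ
    exact Or.inr ⟨hγ, hPQ.imp_right fun h => h.2.2, hl, hr⟩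
  · exact absurd hω.1 hPQ.not_ge
  · rw [norm_exp, Real.one_lt_exp_iff] at hnorm
    exact absurd (hω.2 hQP) hnorm.not_ge

theorem verticalContour_or_loopContour (h : IsContour M N a b ω γ) (hω : ClosesRight P Q ω)
    (hdisj : Disjoint (leftPoles N a) (rightPoles M b)) :
    (0 < decayRate M N P Q ω ∧
      IsVerticalContour γ (leftPoles N a ∪ rightPoles M b) (loopAngle (leftPoles N a))) ∨
    ((P < Q ∨ ω.re < 0) ∧
      IsLoopContour γ (leftPoles N a ∪ rightPoles M b) (loopAngle (leftPoles N a))) := by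
  have hnotMem : ∀ w ∈ rightPoles M b, w ∉ leftPoles N a := fun w hw =>
    disjoint_right.1 hdisj hw
  refine (h.vertical_or_rightLoop hω).imp (fun ⟨hv, hκ, hl, hr⟩ => ⟨hκ, h.1, hv, ?_⟩)
    fun ⟨hv, hu, hl, hr⟩ => ⟨hu, h.1, hv, ?_⟩ <;> rintro w (hw | hw)
  · rw [loopAngle_of_mem hw, zero_add]
    exact hl w hw
  · rw [loopAngle_of_notMem (hnotMem w hw), neg_add_eq_sub, two_mul, sub_add_cancel_left]
    exact hr w hw
  · rw [loopAngle_of_mem hw]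
    exact hl w hw
  · rw [loopAngle_of_notMem (hnotMem w hw)]
    exact hr w hw

end IsContour

theorem im_ne_of_forall_ne (hγ : ∀ w ∈ rightPoles M b, ∀ t, γ t ≠ w) {y T : ℝ}
    (hray : ∀ x ≥ T, ∃ t, γ t = x + y * I) (l : Fin Q) (hl : l.val < M) : (b l).im ≠ y := by
  rintro rfl
  obtain ⟨r, hr⟩ := exists_nat_ge (T - (b l).re)
  obtain ⟨t, ht⟩ := hray ((b l).re + r) (sub_le_iff_le_add'.1 hr)
  exact hγ (b l + r) ⟨l, hl, r, rfl⟩ t (ht.trans (Complex.ext (by simp) (by simp)))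

theorem IsRightLoop.integrable_integrand (hr : IsRightLoop γ) (hγ : IsPiecewiseC1 γ)
    (hPQ : P ≤ Q) (hM : M ≤ Q) (hN : N ≤ P) (hω : P < Q ∨ ω.re < 0)
    (hγb : ∀ w ∈ rightPoles M b, ∀ t, γ t ≠ w)
    (hcont : Continuous fun t => integrand M N a b ω (γ t)) : Converges M N a b ω γ := by
  obtain ⟨y₁, y₂, T, h₁, h₂⟩ := hr
  refine hγ.integrable_mul_deriv (T := T) hcont
    (fun t ht => by rw [h₁ (-t) (by linarith), ofReal_neg]; ring)
    (fun t ht => by rw [h₂ t ht]; ring)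
    (decaysAlong_integrand hPQ hM hN hω a (im_ne_of_forall_ne hγb (T := T) fun x hx => ⟨-x, ?_⟩))
    (decaysAlong_integrand hPQ hM hN hω a
      (im_ne_of_forall_ne hγb fun x hx => ⟨x, h₂ x hx⟩))
  rw [h₁ (-x) (by linarith), ofReal_neg, neg_neg]

theorem IsContour.converges_of_closesRight (h : IsContour M N a b ω γ) (hω : ClosesRight P Q ω)
    (hM : M ≤ Q) (hN : N ≤ P) : Converges M N a b ω γ := by
  rcases h.vertical_or_rightLoop hω with ⟨hv, hκ, -⟩ | ⟨hr, hu, -⟩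
  · exact hv.integrable h.1 h.continuous_integrand (highBound_integrand hω.1 hM hN a b ω) hκ
  · exact hr.integrable_integrand h.1 hω.1 hM hN hu (fun _ => h.ne_of_mem_rightPoles)
      h.continuous_integrand

theorem IsContour.isClosable (h : IsContour M N a b ω γ) (hω : ClosesRight P Q ω) (hM : M ≤ Q)
    (hN : N ≤ P) (hdisj : Disjoint (leftPoles N a) (rightPoles M b))
    (hx : ∀ l, ∀ j : ℤ, (b l).re - x ≠ j) :
    IsClosable (integrand M N a b ω) x (decayRate M N P Q ω) γ (leftPoles N a ∪ rightPoles M b)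
      (loopAngle (leftPoles N a)) where
  integrable := h.converges_of_closesRight hω hM hN
  kind := (h.verticalContour_or_loopContour hω hdisj).imp_right <| And.imp_left fun hu =>
    exists_lineBound_integrand hω.1 hM hN hu a hx

section CongrBounds

variable {f g : ℂ → ℂ} {v u κ : ℝ} {Z Z' : Set ℂ} {φ : ℂ → ℝ}

theorem ExpPolyBound.of_eq_const_mul {D : Set ℂ} (H : ExpPolyBound D g u v) {c : ℂ}
    (hf : ∀ s ∈ D, f s = c * g s) : ExpPolyBound D f u v := by
  have hmul := (ExpPolyBound.const (D := D) c).mul H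
  rw [zero_add, zero_add] at hmul
  exact hmul.of_norm_le fun s hs => (congrArg norm (hf s hs)).le

theorem HighBound.of_eq_const_mul (h : HighBound g v) {c : ℂ}
    (hf : ∀ᶠ Y in atTop, ∀ s : ℂ, Y ≤ |s.im| → f s = c * g s) : HighBound f v := by
  intro B
  obtain ⟨Y, u, H⟩ := h B
  obtain ⟨Y', hY', hYY'⟩ := (hf.and (eventually_ge_atTop Y)).exists
  exact ⟨Y', u, (H.mono fun s hs => ⟨hs.1, hYY'.trans hs.2⟩).of_eq_const_mul
    fun s hs => hY' s hs.2⟩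

theorem LineBound.of_eq_const_mul (h : LineBound g x u v) {c : ℂ}
    (hf : ∀ᶠ N : ℕ in atTop, ∀ s : ℂ, s.re = x + N → f s = c * g s) : LineBound f x u v := by
  obtain ⟨N₀, H⟩ := h
  obtain ⟨N₁, hN₁⟩ := eventually_atTop.1 hf
  refine ⟨max N₀ N₁, (H.mono ?_).of_eq_const_mul (c := c) ?_⟩ <;> rintro s ⟨N, hN, hs⟩
  · exact ⟨N, (le_max_left _ _).trans hN, hs⟩
  · exact hN₁ N ((le_max_right _ _).trans hN) s hs

theorem IsClosable.of_eq_const_mul (hγ : IsClosable g x κ γ Z φ) (hZ : Z' ⊆ Z)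
    (hx : ∀ᶠ N : ℕ in atTop, ∀ w ∈ Z, w.re ≠ x + N) {c : ℂ} (hf : ∀ s ∉ Z, f s = c * g s) :
    IsClosable f x κ γ Z' φ where
  integrable := by
    have hmem : ∀ t, γ t ∉ Z := fun t ht => by
      rcases hγ.kind with ⟨-, h⟩ | ⟨-, h⟩ <;> exact (h.argChange _ ht).1 t rfl
    simpa only [hf _ (hmem _), mul_assoc] using hγ.integrable.const_mul c
  kind := by
    refine hγ.kind.imp (And.imp_right fun h => ?_) (And.imp (fun h => ?_) fun h => ?_)
    · exact ⟨h.isPiecewiseC1, h.isVertical, fun w hw => h.argChange w (hZ hw)⟩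
    · obtain ⟨u, hu, hl⟩ := h
      exact ⟨u, hu, hl.of_eq_const_mul (hx.mono fun N hN s hs => hf s fun hsZ => hN s hsZ hs)⟩
    · exact ⟨h.isPiecewiseC1, h.isRightLoop, fun w hw => h.argChange w (hZ hw)⟩

end CongrBounds

end Contours

/-! ### Separation of the poles -/

section PoleSets

variable {P Q M N : ℕ} {a : Fin P → ℂ} {b : Fin Q → ℂ} {ω : ℂ} {x : ℝ}

section Poles

theorem finite_leftPoles_inter_strip (N : ℕ) (a : Fin P → ℂ) (B X : ℝ) :
    (leftPoles N a ∩ strip B X).Finite := by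
  have hfin : ∀ l, {r : ℕ | (a l).re - 1 - r ∈ Ioo (-B) X}.Finite := fun l => by
    obtain ⟨R, hR⟩ := exists_nat_ge ((a l).re - 1 + B)
    refine (finite_Iio R).subset fun r hr => Nat.cast_lt.1 (?_ : (r : ℝ) < R)
    linarith [hr.1]
  refine (finite_iUnion fun l => (hfin l).image fun r : ℕ => a l - 1 - r).subset ?_
  rintro s ⟨⟨l, -, r, rfl⟩, hs⟩
  exact mem_iUnion.2 ⟨l, r, by simpa [strip] using hs, rfl⟩

theorem finite_rightPoles_inter_strip (M : ℕ) (b : Fin Q → ℂ) (B X : ℝ) :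
    (rightPoles M b ∩ strip B X).Finite := by
  have hfin : ∀ l, {r : ℕ | (b l).re + r ∈ Ioo (-B) X}.Finite := fun l => by
    obtain ⟨R, hR⟩ := exists_nat_ge (X - (b l).re)
    refine (finite_Iio R).subset fun r hr => Nat.cast_lt.1 (?_ : (r : ℝ) < R)
    linarith [hr.2]
  refine (finite_iUnion fun l => (hfin l).image fun r : ℕ => b l + r).subset ?_
  rintro s ⟨⟨l, -, r, rfl⟩, hs⟩
  exact mem_iUnion.2 ⟨l, r, by simpa [strip] using hs, rfl⟩

theorem exists_forall_re_sub_ne_intCast (b : Fin Q → ℂ) :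
    ∃ x : ℝ, ∀ l, ∀ j : ℤ, (b l).re - x ≠ j := by
  obtain ⟨x, hx⟩ := (countable_range fun lj : Fin Q × ℤ => (b lj.1).re - lj.2).dense_compl ℝ
    |>.nonempty
  exact ⟨x, fun l j h => hx ⟨(l, j), sub_eq_of_eq_add' (eq_add_of_sub_eq h)⟩⟩

theorem eventually_re_ne (M N : ℕ) (a : Fin P → ℂ) (hx : ∀ l, ∀ j : ℤ, (b l).re - x ≠ j) :
    ∀ᶠ K : ℕ in atTop, ∀ w ∈ leftPoles N a ∪ rightPoles M b, w.re ≠ x + K := by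
  filter_upwards [eventually_all.2 fun l =>
    (tendsto_add_natCast_atTop x).eventually_ge_atTop (a l).re] with K hK w hw hwK
  rcases hw with ⟨l, -, r, rfl⟩ | ⟨l, -, r, rfl⟩
  · simp only [sub_re, one_re, natCast_re] at hwK
    linarith [hK l, (Nat.cast_nonneg r : (0 : ℝ) ≤ r)]
  · refine hx l (K - r) ?_
    simp only [add_re, natCast_re] at hwK
    push_cast
    linarith

theorem eventually_notMem_leftPoles (N : ℕ) (a : Fin P → ℂ) :
    ∀ᶠ Y in atTop, ∀ s : ℂ, Y ≤ |s.im| → s ∉ leftPoles N a := by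
  filter_upwards [eventually_all.2 fun l => eventually_gt_atTop |(a l).im|] with Y hY s hs
  rintro ⟨l, -, r, rfl⟩
  simp only [sub_im, one_im, natCast_im, sub_zero] at hs
  exact (hY l).not_ge hs

theorem disjoint_leftPoles_rightPoles
    (h : ∀ i : Fin P, i.val < N → ∀ j : Fin Q, j.val < M → ∀ r : ℕ, 0 < r → a i - b j ≠ r) :
    Disjoint (leftPoles N a) (rightPoles M b) := by
  refine disjoint_left.2 ?_
  rintro s ⟨i, hi, r, rfl⟩ ⟨j, hj, r', hr'⟩
  refine h i hi j hj (r + r' + 1) (Nat.succ_pos _) ?_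
  push_cast
  linear_combination hr'

end Poles

section Residues

theorem hasResidueAt_div_prod_sub {F : ℂ → ℂ} {C : Finset ℂ} {w : ℂ} (hw : w ∈ C)
    (hF : AnalyticAt ℂ F w) :
    HasResidueAt (fun s => F s / ∏ c ∈ C, (s - c)) w (F w / ∏ c ∈ C.erase w, (w - c)) := by
  have hprod : AnalyticAt ℂ (fun s => F s / ∏ c ∈ C.erase w, (s - c)) w :=
    hF.fun_div (Finset.analyticAt_fun_prod _ fun c _ => by fun_prop) <|
      Finset.prod_ne_zero_iff.2 fun c hc => sub_ne_zero.2 (Finset.ne_of_mem_erase hc).symm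
  refine (hasResidueAt_div_sub hprod).congr (Eventually.of_forall fun s => ?_)
  simp only [← Finset.prod_erase_mul C _ hw, div_div]

theorem exists_hasPoles {g r : ℂ → ℂ} {Z : Set ℂ} {C : Finset ℂ} (hg : ∀ s ∉ Z, AnalyticAt ℂ g s)
    (hm : ∀ w ∈ Z, MeromorphicAt g w) (hr : ∀ w ∈ C, HasResidueAt g w (r w))
    (hfin : ∀ B X, (Z ∩ strip B X).Finite) : ∃ ρ, HasPoles g Z ρ ∧ ∀ w ∈ C, ρ w = r w := by
  have hres : ∀ w, ∃ c, (w ∈ Z → HasResidueAt g w c) ∧ (w ∈ C → c = r w) := fun w => by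
    by_cases hwC : w ∈ C
    · exact ⟨r w, fun _ => hr w hwC, fun _ => rfl⟩
    by_cases hwZ : w ∈ Z
    · obtain ⟨c, hc⟩ := exists_hasResidueAt_of_meromorphicAt (hm w hwZ)
      exact ⟨c, fun _ => hc, fun h => absurd h hwC⟩
    · exact ⟨0, fun h => absurd h hwZ, fun h => absurd h hwC⟩
  choose ρ hρ hρC using hres
  exact ⟨ρ, ⟨hg, hρ, hfin⟩, hρC⟩

end Residues

section Ladder

/-- The finite arithmetic progression `β, β + 1, …, β + (k - 1)`, over which the sum in the
connection formula runs. -/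
def ladder (β : ℂ) (k : ℕ) : Finset ℂ :=
  (Finset.range k).map (Nat.castEmbedding.trans (addLeftEmbedding β))

theorem mem_ladder {β c : ℂ} {k : ℕ} : c ∈ ladder β k ↔ ∃ i < k, β + i = c := by
  simp [ladder]

theorem prod_erase_range_natCast_sub (i d : ℕ) :
    ∏ j ∈ (Finset.range (i + 1 + d)).erase i, ((i : ℂ) - j) =
      (-1) ^ d * (i.factorial * d.factorial) := by
  induction d with
  | zero =>
    rw [add_zero, Finset.range_add_one, Finset.erase_insert Finset.notMem_range_self,
      Finset.prod_range_natCast_sub, ← Nat.descFactorial_eq_prod_range, Nat.descFactorial_self]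
    simp
  | succ d ih =>
    rw [← add_assoc, Finset.range_add_one, Finset.erase_insert_of_ne (by omega),
      Finset.prod_insert (by simp), ih, Nat.factorial_succ]
    push_cast
    ring

theorem prod_erase_ladder_sub (β : ℂ) {i k : ℕ} (hi : i < k) :
    ∏ c ∈ (ladder β k).erase (β + i), (β + i - c) =
      (-1) ^ (k - 1 - i) * (i.factorial * (k - 1 - i).factorial) := by
  have herase : (ladder β k).erase (β + i) =
      ((Finset.range k).erase i).map (Nat.castEmbedding.trans (addLeftEmbedding β)) :=
    (Finset.map_erase _ _ _).symm
  rw [herase, Finset.prod_map, ← prod_erase_range_natCast_sub,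
    show i + 1 + (k - 1 - i) = k by omega]
  exact Finset.prod_congr rfl fun j _ => add_sub_add_left_eq_sub _ _ _

end Ladder

end PoleSets

/-! ### The common integrand -/

section Resonance

variable {P Q : ℕ} {a : Fin P → ℂ} {b : Fin Q → ℂ} {i₀ : Fin P} {j₀ : Fin Q} {k : ℕ} {ω s : ℂ}

section CommonIntegrand

theorem prod_filter_val_lt_succ {R : Type*} [CommMonoid R] {n : ℕ} (i : Fin n) (f : Fin n → R) :
    ∏ l with l.val < i.val + 1, f l = f i * ∏ l with l.val < i.val, f l := by
  rw [← Finset.prod_insert (by simp)]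
  congr 1
  ext l
  simp only [Finset.mem_filter_univ, Finset.mem_insert, Fin.ext_iff]
  omega

theorem prod_filter_le_val {R : Type*} [CommMonoid R] {n : ℕ} (i : Fin n) (f : Fin n → R) :
    ∏ l with i.val ≤ l.val, f l = f i * ∏ l with i.val + 1 ≤ l.val, f l := by
  rw [← Finset.prod_insert (by simp)]
  congr 1
  ext l
  simp only [Finset.mem_filter_univ, Finset.mem_insert, Fin.ext_iff]
  omega

/-- The integrand without the four possible factors that involve `a i₀` or `b j₀`. -/
def commonFactor (a : Fin P → ℂ) (b : Fin Q → ℂ) (i₀ : Fin P) (j₀ : Fin Q) (ω s : ℂ) : ℂ :=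
  gammaQuotient {l | l.val < j₀} {l | j₀ + 1 ≤ l.val} {l | l.val < i₀} {l | i₀ + 1 ≤ l.val} a b ω s

/-- The function with which the integrands of both `G`-functions agree up to sign when
`a i₀ - b j₀ = k`. -/
def commonIntegrand (a : Fin P → ℂ) (b : Fin Q → ℂ) (i₀ : Fin P) (j₀ : Fin Q) (k : ℕ)
    (ω s : ℂ) : ℂ :=
  commonFactor a b i₀ j₀ ω s / ∏ c ∈ ladder (b j₀) k, (s - c)

theorem integrand_eq_commonFactor_div (a : Fin P → ℂ) (b : Fin Q → ℂ) (i₀ : Fin P) (j₀ : Fin Q)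
    (ω s : ℂ) : integrand j₀ i₀ a b ω s =
      commonFactor a b i₀ j₀ ω s / (Gamma (1 - b j₀ + s) * Gamma (a i₀ - s)) := by
  rw [integrand, commonFactor, gammaQuotient, prod_filter_le_val, prod_filter_le_val]
  ring

theorem integrand_succ_right_eq_commonFactor_mul (a : Fin P → ℂ) (b : Fin Q → ℂ) (i₀ : Fin P)
    (j₀ : Fin Q) (ω s : ℂ) : integrand j₀ (i₀ + 1) a b ω s =
      commonFactor a b i₀ j₀ ω s * (Gamma (1 - a i₀ + s) / Gamma (1 - b j₀ + s)) := by
  rw [integrand, commonFactor, gammaQuotient, prod_filter_le_val, prod_filter_val_lt_succ]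
  ring

theorem integrand_succ_left_eq_commonFactor_mul (a : Fin P → ℂ) (b : Fin Q → ℂ) (i₀ : Fin P)
    (j₀ : Fin Q) (ω s : ℂ) : integrand (j₀ + 1) i₀ a b ω s =
      commonFactor a b i₀ j₀ ω s * (Gamma (b j₀ - s) / Gamma (a i₀ - s)) := by
  rw [integrand, commonFactor, gammaQuotient, prod_filter_le_val, prod_filter_val_lt_succ]
  ring

theorem Gamma_div_Gamma_add_natCast {z : ℂ} (hz : ∀ r : ℕ, z ≠ -r) (k : ℕ) :
    Gamma z / Gamma (z + k) = (∏ j ∈ Finset.range k, (z + j))⁻¹ := by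
  refine (inv_eq_of_mul_eq_one_right ?_).symm
  rw [div_eq_mul_inv, mul_left_comm, ← inv_Gamma_eq_prod_mul_inv_Gamma_add_natCast,
    mul_inv_cancel₀ (Gamma_ne_zero hz)]

theorem prod_range_sub_add_natCast (β s : ℂ) (k : ℕ) :
    ∏ j ∈ Finset.range k, (β - s + j) = (-1) ^ k * ∏ c ∈ ladder β k, (s - c) := by
  rw [ladder, Finset.prod_map, ← Finset.card_range k, ← Finset.prod_const, Finset.card_range,
    ← Finset.prod_mul_distrib]
  refine Finset.prod_congr rfl fun j _ => ?_
  simp only [Function.Embedding.trans_apply, Nat.castEmbedding_apply, addLeftEmbedding_apply]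
  ring

theorem prod_range_one_sub_add_natCast (β s : ℂ) (k : ℕ) :
    ∏ j ∈ Finset.range k, (1 - (β + k) + s + j) = ∏ c ∈ ladder β k, (s - c) := by
  rw [ladder, Finset.prod_map, ← Finset.prod_range_reflect]
  refine Finset.prod_congr rfl fun j hj => ?_
  rw [Nat.sub_sub, Nat.cast_sub (by have := Finset.mem_range.1 hj; omega)]
  simp only [Function.Embedding.trans_apply, Nat.castEmbedding_apply, addLeftEmbedding_apply]
  push_cast
  ring

theorem integrand_succ_right_eq_commonIntegrand (hab : a i₀ - b j₀ = k)
    (hs : s ∉ leftPoles (i₀ + 1) a) :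
    integrand j₀ (i₀ + 1) a b ω s = commonIntegrand a b i₀ j₀ k ω s := by
  have hΓ := Gamma_div_Gamma_add_natCast (z := 1 - a i₀ + s)
    (fun r h => hs ⟨i₀, Nat.lt_succ_self _, r, by linear_combination h⟩) k
  rw [show 1 - a i₀ + s + k = 1 - b j₀ + s by rw [← hab]; ring] at hΓ
  rw [integrand_succ_right_eq_commonFactor_mul, hΓ, eq_add_of_sub_eq' hab,
    prod_range_one_sub_add_natCast, commonIntegrand, div_eq_mul_inv]

theorem integrand_succ_left_eq_commonIntegrand (hab : a i₀ - b j₀ = k)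
    (hs : s ∉ rightPoles (j₀ + 1) b) :
    integrand (j₀ + 1) i₀ a b ω s = (-1) ^ k * commonIntegrand a b i₀ j₀ k ω s := by
  have hΓ := Gamma_div_Gamma_add_natCast (z := b j₀ - s)
    (fun r h => hs ⟨j₀, Nat.lt_succ_self _, r, by linear_combination -h⟩) k
  rw [show b j₀ - s + k = a i₀ - s by rw [← hab]; ring] at hΓ
  rw [integrand_succ_left_eq_commonFactor_mul, hΓ, prod_range_sub_add_natCast, mul_inv, ← inv_pow,
    inv_neg_one, commonIntegrand]
  ring

theorem commonFactor_div_prod_erase_ladder (hab : a i₀ - b j₀ = k) {i : ℕ} (hi : i < k) :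
    commonFactor a b i₀ j₀ ω (b j₀ + i) / ∏ c ∈ (ladder (b j₀) k).erase (b j₀ + i), (b j₀ + i - c) =
      (-1) ^ (k - 1 - i) * integrand j₀ i₀ a b ω (b j₀ + i) := by
  have hb : 1 - b j₀ + (b j₀ + i) = i + 1 := by ring
  have ha : a i₀ - (b j₀ + i) = (k - 1 - i : ℕ) + 1 := by
    rw [← sub_sub, hab, Nat.sub_sub, Nat.cast_sub (by omega)]
    push_cast
    ring
  rw [prod_erase_ladder_sub _ hi, integrand_eq_commonFactor_div, hb, ha, Gamma_nat_eq_factorial,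
    Gamma_nat_eq_factorial, div_mul_eq_div_div, div_eq_mul_inv _ ((-1) ^ _), ← inv_pow, inv_neg_one]
  ring

end CommonIntegrand

theorem ladder_subset_rightPoles (b : Fin Q → ℂ) (j₀ : Fin Q) (k : ℕ) :
    ↑(ladder (b j₀) k) ⊆ rightPoles (j₀ + 1) b := by
  intro c hc
  obtain ⟨i, -, rfl⟩ := mem_ladder.1 hc
  exact ⟨j₀, Nat.lt_succ_self _, i, rfl⟩

/-- The difference `a i₀ - b j₀` is the natural number `k`, and no other difference `a i - b j` with
`i ≤ i₀` and `j ≤ j₀` is a positive integer. -/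
structure IsResonant (a : Fin P → ℂ) (b : Fin Q → ℂ) (i₀ : Fin P) (j₀ : Fin Q) (k : ℕ) : Prop where
  sub_eq : a i₀ - b j₀ = k
  sub_ne : ∀ i ≤ i₀, ∀ j ≤ j₀, (i, j) ≠ (i₀, j₀) → ∀ r : ℕ, 0 < r → a i - b j ≠ r

namespace IsResonant

theorem reflect (h : IsResonant a b i₀ j₀ k) :
    IsResonant (fun j => 1 - b j) (fun i => 1 - a i) j₀ i₀ k where
  sub_eq := (sub_sub_sub_cancel_left ..).trans h.sub_eq
  sub_ne j hj i hi hij r hr := by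
    rw [sub_sub_sub_cancel_left]
    exact h.sub_ne i hi j hj (fun h => hij (congrArg Prod.swap h)) r hr

theorem ladder_subset_leftPoles (h : IsResonant a b i₀ j₀ k) :
    ↑(ladder (b j₀) k) ⊆ leftPoles (i₀ + 1) a := by
  intro c hc
  obtain ⟨i, hi, rfl⟩ := mem_ladder.1 hc
  refine ⟨i₀, Nat.lt_succ_self _, k - 1 - i, ?_⟩
  rw [Nat.sub_sub, Nat.cast_sub (by omega), ← h.sub_eq]
  push_cast
  ring

theorem disjoint_leftPoles_succ (h : IsResonant a b i₀ j₀ k) :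
    Disjoint (leftPoles (i₀ + 1) a) (rightPoles j₀ b) :=
  disjoint_leftPoles_rightPoles fun i hi j hj => h.sub_ne i (Nat.le_of_lt_succ hi) j
    (Fin.le_of_lt hj) fun hij => (Fin.ne_of_lt hj) (congrArg Prod.snd hij)

theorem disjoint_rightPoles_succ (h : IsResonant a b i₀ j₀ k) :
    Disjoint (leftPoles i₀ a) (rightPoles (j₀ + 1) b) :=
  disjoint_leftPoles_rightPoles fun i hi j hj => h.sub_ne i (Fin.le_of_lt hi) j
    (Nat.le_of_lt_succ hj) fun hij => (Fin.ne_of_lt hi) (congrArg Prod.fst hij)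

end IsResonant

end Resonance

/-! ### The connection formula for right contours -/

section Connection

variable {P Q : ℕ} {a : Fin P → ℂ} {b : Fin Q → ℂ} {i₀ : Fin P} {j₀ : Fin Q} {k : ℕ} {ω s : ℂ}
  {x : ℝ} {γ γ₁ γ₂ : ℝ → ℂ}

theorem leftPoles_mono {N N' : ℕ} (h : N ≤ N') (a : Fin P → ℂ) :
    leftPoles N a ⊆ leftPoles N' a := fun _ ⟨l, hl, hs⟩ => ⟨l, hl.trans_le h, hs⟩

theorem rightPoles_mono {M M' : ℕ} (h : M ≤ M') (b : Fin Q → ℂ) :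
    rightPoles M b ⊆ rightPoles M' b := fun _ ⟨l, hl, hs⟩ => ⟨l, hl.trans_le h, hs⟩

/-- A set that contains all poles of `commonIntegrand`. -/
def commonPoles (a : Fin P → ℂ) (b : Fin Q → ℂ) (i₀ : Fin P) (j₀ : Fin Q) (k : ℕ) : Set ℂ :=
  leftPoles i₀ a ∪ rightPoles j₀ b ∪ ladder (b j₀) k

theorem analyticAt_commonFactor (hl : s ∉ leftPoles i₀ a) (hr : s ∉ rightPoles j₀ b) :
    AnalyticAt ℂ (commonFactor a b i₀ j₀ ω) s :=
  analyticAt_gammaQuotient (fun l hl r hs => hr ⟨l, (Finset.mem_filter.1 hl).2, r, hs⟩)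
    fun l hl' r hs => hl ⟨l, (Finset.mem_filter.1 hl').2, r, hs⟩

theorem analyticAt_commonIntegrand (hs : s ∉ commonPoles a b i₀ j₀ k) :
    AnalyticAt ℂ (commonIntegrand a b i₀ j₀ k ω) s := by
  simp only [commonPoles, mem_union, not_or] at hs
  refine (analyticAt_commonFactor hs.1.1 hs.1.2).fun_div
    (Finset.analyticAt_fun_prod _ fun c _ => by fun_prop) <|
    Finset.prod_ne_zero_iff.2 fun c hc => sub_ne_zero.2 ?_
  rintro rfl
  exact hs.2 hc

theorem meromorphicAt_commonIntegrand : MeromorphicAt (commonIntegrand a b i₀ j₀ k ω) s :=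
  meromorphicAt_gammaQuotient.fun_div (MeromorphicAt.fun_prod fun c _ => by fun_prop)

theorem finite_commonPoles_inter_strip (B X : ℝ) :
    (commonPoles a b i₀ j₀ k ∩ strip B X).Finite := by
  rw [commonPoles, union_inter_distrib_right, union_inter_distrib_right]
  exact ((finite_leftPoles_inter_strip _ a B X).union
    (finite_rightPoles_inter_strip _ b B X)).union ((Finset.finite_toSet _).inter_of_left _)

theorem commonPoles_subset_succ_right (a : Fin P → ℂ) (b : Fin Q → ℂ) (i₀ : Fin P) (j₀ : Fin Q)
    (k : ℕ) : commonPoles a b i₀ j₀ k ⊆ leftPoles i₀ a ∪ rightPoles (j₀ + 1) b :=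
  union_subset (union_subset_union_right _ (rightPoles_mono (Nat.le_succ _) b))
    ((ladder_subset_rightPoles b j₀ k).trans subset_union_right)

namespace IsResonant

theorem commonPoles_subset_succ_left (h : IsResonant a b i₀ j₀ k) :
    commonPoles a b i₀ j₀ k ⊆ leftPoles (i₀ + 1) a ∪ rightPoles j₀ b :=
  union_subset (union_subset_union_left _ (leftPoles_mono (Nat.le_succ _) a))
    (h.ladder_subset_leftPoles.trans subset_union_left)

theorem analyticAt_commonFactor_of_mem_ladder (h : IsResonant a b i₀ j₀ k)
    (hs : s ∈ ladder (b j₀) k) : AnalyticAt ℂ (commonFactor a b i₀ j₀ ω) s :=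
  analyticAt_commonFactor
    (disjoint_right.1 h.disjoint_rightPoles_succ (ladder_subset_rightPoles b j₀ k hs))
    (disjoint_left.1 h.disjoint_leftPoles_succ (h.ladder_subset_leftPoles hs))

theorem exists_hasPoles_commonIntegrand (h : IsResonant a b i₀ j₀ k) (ω : ℂ) :
    ∃ ρ, HasPoles (commonIntegrand a b i₀ j₀ k ω) (commonPoles a b i₀ j₀ k) ρ ∧
      ∀ c ∈ ladder (b j₀) k, ρ c =
        commonFactor a b i₀ j₀ ω c / ∏ c' ∈ (ladder (b j₀) k).erase c, (c - c') :=
  exists_hasPoles (fun _ => analyticAt_commonIntegrand) (fun _ _ => meromorphicAt_commonIntegrand)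
    (fun _ hc => hasResidueAt_div_prod_sub hc (h.analyticAt_commonFactor_of_mem_ladder hc))
    finite_commonPoles_inter_strip

theorem highBound_commonIntegrand (h : IsResonant a b i₀ j₀ k) (hPQ : P ≤ Q) (ω : ℂ) :
    HighBound (commonIntegrand a b i₀ j₀ k ω) (-decayRate j₀ (i₀ + 1) P Q ω) :=
  (highBound_integrand hPQ j₀.2.le i₀.2 a b ω).of_eq_const_mul (c := 1) <|
    (eventually_notMem_leftPoles (i₀ + 1) a).mono fun Y hY s hs => by
      rw [integrand_succ_right_eq_commonIntegrand h.sub_eq (hY s hs), one_mul]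

theorem isClosable_succ_right (h : IsResonant a b i₀ j₀ k) (hω : ClosesRight P Q ω)
    (hγ : IsContour j₀ (i₀ + 1) a b ω γ) (hx : ∀ l, ∀ j : ℤ, (b l).re - x ≠ j) :
    IsClosable (commonIntegrand a b i₀ j₀ k ω) x (decayRate j₀ (i₀ + 1) P Q ω) γ
      (commonPoles a b i₀ j₀ k) (loopAngle (leftPoles (i₀ + 1) a)) :=
  (hγ.isClosable hω j₀.2.le i₀.2 h.disjoint_leftPoles_succ hx).of_eq_const_mul (c := 1)
    h.commonPoles_subset_succ_left (eventually_re_ne _ _ a hx) fun s hs => by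
      rw [integrand_succ_right_eq_commonIntegrand h.sub_eq fun hs' => hs (Or.inl hs'), one_mul]

theorem isClosable_succ_left (h : IsResonant a b i₀ j₀ k) (hω : ClosesRight P Q ω)
    (hγ : IsContour (j₀ + 1) i₀ a b ω γ) (hx : ∀ l, ∀ j : ℤ, (b l).re - x ≠ j) :
    IsClosable (commonIntegrand a b i₀ j₀ k ω) x (decayRate (j₀ + 1) i₀ P Q ω) γ
      (commonPoles a b i₀ j₀ k) (loopAngle (leftPoles i₀ a)) :=
  (hγ.isClosable hω j₀.2 i₀.2.le h.disjoint_rightPoles_succ hx).of_eq_const_mul (c := (-1) ^ k)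
    (commonPoles_subset_succ_right a b i₀ j₀ k) (eventually_re_ne _ _ a hx) fun s hs => by
      rw [integrand_succ_left_eq_commonIntegrand h.sub_eq fun hs' => hs (Or.inr hs'), ← mul_assoc,
        pow_mul_pow_eq_one k (by norm_num), one_mul]

theorem loopAngle_eq_of_notMem_ladder (h : IsResonant a b i₀ j₀ k)
    (hs : s ∈ commonPoles a b i₀ j₀ k) (hsl : s ∉ ladder (b j₀) k) :
    loopAngle (leftPoles (i₀ + 1) a) s = loopAngle (leftPoles i₀ a) s := by
  rcases hs.resolve_right hsl with hl | hr
  · rw [loopAngle_of_mem hl, loopAngle_of_mem (leftPoles_mono (Nat.le_succ _) a hl)]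
  · rw [loopAngle_of_notMem (disjoint_right.1 h.disjoint_leftPoles_succ hr),
      loopAngle_of_notMem (disjoint_right.1 h.disjoint_rightPoles_succ
        (rightPoles_mono (Nat.le_succ _) b hr))]

theorem loopAngle_sub_loopAngle_of_mem_ladder (h : IsResonant a b i₀ j₀ k)
    (hs : s ∈ ladder (b j₀) k) :
    loopAngle (leftPoles (i₀ + 1) a) s - loopAngle (leftPoles i₀ a) s = 2 * π := by
  rw [loopAngle_of_mem (h.ladder_subset_leftPoles hs), loopAngle_of_notMem
    (disjoint_right.1 h.disjoint_rightPoles_succ (ladder_subset_rightPoles b j₀ k hs)), zero_sub,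
    neg_neg]

theorem integral_commonIntegrand_sub_integral (h : IsResonant a b i₀ j₀ k)
    (hω : ClosesRight P Q ω) (hγ₁ : IsContour j₀ (i₀ + 1) a b ω γ₁)
    (hγ₂ : IsContour (j₀ + 1) i₀ a b ω γ₂) :
    (∫ t, commonIntegrand a b i₀ j₀ k ω (γ₁ t) * deriv γ₁ t) -
        ∫ t, commonIntegrand a b i₀ j₀ k ω (γ₂ t) * deriv γ₂ t =
      2 * π * I * ∑ i ∈ Finset.range k, (-1) ^ (k - 1 - i) * integrand j₀ i₀ a b ω (b j₀ + i) := by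
  obtain ⟨x, hx⟩ := exists_forall_re_sub_ne_intCast b
  obtain ⟨ρ, hρ, hρC⟩ := h.exists_hasPoles_commonIntegrand ω
  have hκ : decayRate (j₀ + 1) i₀ P Q ω = decayRate j₀ (i₀ + 1) P Q ω := by
    rw [decayRate, decayRate]
    push_cast
    ring
  rw [(h.isClosable_succ_right hω hγ₁ hx).integral_sub_integral
    (hκ ▸ h.isClosable_succ_left hω hγ₂ hx) hρ (h.highBound_commonIntegrand hω.1 ω)
    ((eventually_re_ne _ _ a hx).mono fun K hK w hw => hK w (h.commonPoles_subset_succ_left hw))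
    subset_union_right fun w => h.loopAngle_eq_of_notMem_ladder, Finset.mul_sum, ladder,
    Finset.sum_map]
  refine Finset.sum_congr rfl fun i hi => ?_
  have hi' : b j₀ + i ∈ ladder (b j₀) k := mem_ladder.2 ⟨i, Finset.mem_range.1 hi, rfl⟩
  rw [← commonFactor_div_prod_erase_ladder h.sub_eq (Finset.mem_range.1 hi), ← hρC _ hi']
  simp only [Function.Embedding.trans_apply, Nat.castEmbedding_apply, addLeftEmbedding_apply]
  rw [← ofReal_sub, h.loopAngle_sub_loopAngle_of_mem_ladder hi']
  push_cast
  ring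

theorem meijerG_sub_meijerG_of_closesRight (h : IsResonant a b i₀ j₀ k) (hω : ClosesRight P Q ω)
    (hγ₁ : IsContour j₀ (i₀ + 1) a b ω γ₁) (hγ₂ : IsContour (j₀ + 1) i₀ a b ω γ₂) :
    meijerG j₀ (i₀ + 1) a b ω γ₁ - (-1) ^ k * meijerG (j₀ + 1) i₀ a b ω γ₂ =
      ∑ i ∈ Finset.range k, (-1) ^ (k - 1 - i) * integrand j₀ i₀ a b ω (b j₀ + i) := by
  have h₁ (t) := integrand_succ_right_eq_commonIntegrand (ω := ω) h.sub_eq (hγ₁.notMem_leftPoles t)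
  have h₂ (t) := integrand_succ_left_eq_commonIntegrand (ω := ω) h.sub_eq (hγ₂.notMem_rightPoles t)
  have hsq : (-1 : ℂ) ^ k * (-1) ^ k = 1 := pow_mul_pow_eq_one k (by norm_num)
  simp only [meijerG, h₁, h₂, mul_assoc ((-1 : ℂ) ^ k)]
  rw [integral_const_mul, mul_left_comm, ← mul_assoc ((-1) ^ k), hsq, one_mul, ← mul_sub,
    h.integral_commonIntegrand_sub_integral hω hγ₁ hγ₂, inv_mul_cancel_left₀ two_pi_I_ne_zero]

end IsResonant

end Connection

/-! ### Reflection -/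

section Reflection

variable {P Q M N : ℕ} {a : Fin P → ℂ} {b : Fin Q → ℂ} {ω : ℂ} {γ : ℝ → ℂ}

/-- The curve `-γ`, traversed backwards: the reflection `s ↦ -s` turns left loops into right loops,
and reversing the direction keeps vertical curves upward. -/
def negReverse (γ : ℝ → ℂ) (t : ℝ) : ℂ :=
  -γ (-t)

theorem deriv_negReverse (γ : ℝ → ℂ) (t : ℝ) : deriv (negReverse γ) t = deriv γ (-t) := by
  unfold negReverse
  rw [deriv.fun_neg, deriv_comp_neg, neg_neg]

theorem isPiecewiseC1_negReverse (h : IsPiecewiseC1 γ) : IsPiecewiseC1 (negReverse γ) := by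
  obtain ⟨hl, S, hS, hd⟩ := h
  refine ⟨(LipschitzWith.id.neg.locallyLipschitz.comp hl).comp
    LipschitzWith.id.neg.locallyLipschitz, -S, hS.neg, fun t ht => ?_⟩
  exact ((hd (-t) (by simpa using ht)).comp t contDiff_neg.contDiffAt).neg

theorem argChange_negReverse {w : ℂ} {θ : ℝ} (h : ArgChange γ w θ) :
    ArgChange (negReverse γ) (-w) (-θ) := by
  refine ⟨fun t ht => h.1 (-t) (neg_injective ht), h.2.neg.congr fun R => ?_⟩
  have hlog (t : ℝ) : deriv (negReverse γ) t / (negReverse γ t - -w) =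
      -(deriv γ (-t) / (γ (-t) - w)) := by
    rw [deriv_negReverse, negReverse, ← neg_sub', div_neg]
  simp only [hlog]
  rw [intervalIntegral.integral_neg,
    intervalIntegral.integral_comp_neg fun t => deriv γ t / (γ t - w), neg_neg, neg_im]

theorem isVertical_negReverse (h : IsVertical γ) : IsVertical (negReverse γ) := by
  obtain ⟨x₁, x₂, T, h₁, h₂⟩ := h
  refine ⟨-x₂, -x₁, T, fun t ht => ?_, fun t ht => ?_⟩
  · rw [negReverse, h₂ _ (le_neg_of_le_neg ht)]
    push_cast
    ring
  · rw [negReverse, h₁ _ (neg_le_neg ht)]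
    push_cast
    ring

theorem isLeftLoop_negReverse (h : IsRightLoop γ) : IsLeftLoop (negReverse γ) := by
  obtain ⟨y₁, y₂, T, h₁, h₂⟩ := h
  refine ⟨-y₂, -y₁, T, fun t ht => ?_, fun t ht => ?_⟩
  · rw [negReverse, h₂ _ (le_neg_of_le_neg ht)]
    push_cast
    ring
  · rw [negReverse, h₁ _ (neg_le_neg ht)]
    push_cast
    ring

theorem isRightLoop_negReverse (h : IsLeftLoop γ) : IsRightLoop (negReverse γ) := by
  obtain ⟨y₁, y₂, T, h₁, h₂⟩ := h
  refine ⟨-y₂, -y₁, T, fun t ht => ?_, fun t ht => ?_⟩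
  · rw [negReverse, h₂ _ (le_neg_of_le_neg ht)]
    push_cast
    ring
  · rw [negReverse, h₁ _ (neg_le_neg ht)]
    push_cast
    ring

theorem forall_argChange_leftPoles_negReverse {θ : ℝ} (h : ∀ w ∈ rightPoles M b, ArgChange γ w θ) :
    ∀ w ∈ leftPoles M fun l => 1 - b l, ArgChange (negReverse γ) w (-θ) := by
  rintro w ⟨l, hl, r, rfl⟩
  convert argChange_negReverse (h _ ⟨l, hl, r, rfl⟩) using 1
  ring

theorem forall_argChange_rightPoles_negReverse {θ : ℝ} (h : ∀ w ∈ leftPoles N a, ArgChange γ w θ) :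
    ∀ w ∈ rightPoles N fun l => 1 - a l, ArgChange (negReverse γ) w (-θ) := by
  rintro w ⟨l, hl, r, rfl⟩
  convert argChange_negReverse (h _ ⟨l, hl, r, rfl⟩) using 1
  ring

theorem IsContour.reflect (h : IsContour M N a b ω γ) :
    IsContour N M (fun l => 1 - b l) (fun l => 1 - a l) (-ω) (negReverse γ) := by
  refine ⟨isPiecewiseC1_negReverse h.1, ?_⟩
  rcases h.2 with ⟨hv, hPQ, him, hl, hr⟩ | ⟨hγ, hPQ, hl, hr⟩ | ⟨hγ, hPQ, hl, hr⟩ <;>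
    replace hl := forall_argChange_rightPoles_negReverse hl <;>
    replace hr := forall_argChange_leftPoles_negReverse hr <;>
    simp only [neg_neg, neg_zero] at hl hr
  · refine Or.inl ⟨isVertical_negReverse hv, by omega, ?_, hr, hl⟩
    rwa [neg_im, abs_neg, add_comm (N : ℝ), add_comm (Q : ℝ)]
  · refine Or.inr (Or.inr ⟨isLeftLoop_negReverse hγ, hPQ.imp_right ?_, hr, hl⟩)
    rintro ⟨rfl, hP, hz⟩
    rw [exp_neg, norm_inv]
    exact ⟨rfl, hP, (one_lt_inv₀ (norm_pos_iff.2 (exp_ne_zero _))).2 hz⟩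
  · refine Or.inr (Or.inl ⟨isRightLoop_negReverse hγ, hPQ.imp_right ?_, hr, hl⟩)
    rintro ⟨rfl, hP, hz⟩
    rw [exp_neg, norm_inv]
    exact ⟨rfl, hP, inv_lt_one_of_one_lt₀ hz⟩

theorem integrand_reflect (M N : ℕ) (a : Fin P → ℂ) (b : Fin Q → ℂ) (ω s : ℂ) :
    integrand N M (fun l => 1 - b l) (fun l => 1 - a l) (-ω) s = integrand M N a b ω (-s) := by
  simp only [integrand, sub_sub_cancel, sub_right_comm _ _ s, ← sub_eq_add_neg, sub_neg_eq_add,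
    mul_neg, neg_mul]
  rw [mul_comm (∏ l : Fin P with l.val < N, _), mul_comm (∏ l : Fin P with N ≤ l.val, _)]

theorem integrand_mul_deriv_negReverse (M N : ℕ) (a : Fin P → ℂ) (b : Fin Q → ℂ) (ω : ℂ)
    (γ : ℝ → ℂ) (t : ℝ) :
    integrand N M (fun l => 1 - b l) (fun l => 1 - a l) (-ω) (negReverse γ t) *
      deriv (negReverse γ) t = integrand M N a b ω (γ (-t)) * deriv γ (-t) := by
  rw [integrand_reflect, deriv_negReverse, negReverse, neg_neg]

theorem converges_of_reflect
    (h : Converges N M (fun l => 1 - b l) (fun l => 1 - a l) (-ω) (negReverse γ)) :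
    Converges M N a b ω γ := by
  simpa only [Converges, integrand_mul_deriv_negReverse, neg_neg] using Integrable.comp_neg h

theorem meijerG_reflect (M N : ℕ) (a : Fin P → ℂ) (b : Fin Q → ℂ) (ω : ℂ) (γ : ℝ → ℂ) :
    meijerG N M (fun l => 1 - b l) (fun l => 1 - a l) (-ω) (negReverse γ) =
      meijerG M N a b ω γ := by
  simp only [meijerG, integrand_mul_deriv_negReverse]
  rw [integral_neg_eq_self fun t => integrand M N a b ω (γ t) * deriv γ t]

theorem IsContour.converges (h : IsContour M N a b ω γ) (hM : M ≤ Q) (hN : N ≤ P) :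
    Converges M N a b ω γ :=
  (closesRight_or_closesRight_neg P Q ω).elim (fun hω => h.converges_of_closesRight hω hM hN)
    fun hω => converges_of_reflect (h.reflect.converges_of_closesRight hω hN hM)

theorem neg_neg_one_pow_mul_neg_one_pow {i k : ℕ} (hi : i < k) :
    -(-1 : ℂ) ^ k * (-1) ^ (k - 1 - i) = (-1) ^ i := by
  obtain ⟨d, rfl⟩ := Nat.exists_eq_add_of_lt hi
  rw [show i + d + 1 - 1 - i = d by omega]
  linear_combination (-1 : ℂ) ^ i * pow_mul_pow_eq_one d (by norm_num : (-1 : ℂ) * -1 = 1)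

theorem IsResonant.integrand_reflect_add {i₀ : Fin P} {j₀ : Fin Q} {k i : ℕ}
    (h : IsResonant a b i₀ j₀ k) (hi : i < k) (ω : ℂ) :
    integrand i₀ j₀ (fun l => 1 - b l) (fun l => 1 - a l) (-ω) (1 - a i₀ + i) =
      integrand j₀ i₀ a b ω (b j₀ + (k - 1 - i : ℕ)) := by
  rw [integrand_reflect, Nat.sub_sub, Nat.cast_sub (by omega), ← h.sub_eq]
  congr 1
  push_cast
  ring

theorem IsResonant.meijerG_sub_meijerG {i₀ : Fin P} {j₀ : Fin Q} {k : ℕ} {γ₁ γ₂ : ℝ → ℂ}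
    (h : IsResonant a b i₀ j₀ k) (hγ₁ : IsContour j₀ (i₀ + 1) a b ω γ₁)
    (hγ₂ : IsContour (j₀ + 1) i₀ a b ω γ₂) :
    meijerG j₀ (i₀ + 1) a b ω γ₁ - (-1) ^ k * meijerG (j₀ + 1) i₀ a b ω γ₂ =
      ∑ i ∈ Finset.range k, (-1) ^ (k - 1 - i) * integrand j₀ i₀ a b ω (b j₀ + i) := by
  rcases closesRight_or_closesRight_neg P Q ω with hω | hω
  · exact h.meijerG_sub_meijerG_of_closesRight hω hγ₁ hγ₂
  have hrefl := h.reflect.meijerG_sub_meijerG_of_closesRight hω hγ₂.reflect hγ₁.reflect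
  rw [meijerG_reflect, meijerG_reflect] at hrefl
  have hsq : (-1 : ℂ) ^ k * (-1) ^ k = 1 := pow_mul_pow_eq_one k (by norm_num)
  calc
    _ = -(-1) ^ k * (meijerG (j₀ + 1) i₀ a b ω γ₂ - (-1) ^ k * meijerG j₀ (i₀ + 1) a b ω γ₁) := by
      linear_combination -meijerG j₀ (i₀ + 1) a b ω γ₁ * hsq
    _ = _ := by
      rw [hrefl, Finset.mul_sum,
        ← Finset.sum_range_reflect fun i => (-1) ^ (k - 1 - i) * integrand j₀ i₀ a b ω (b j₀ + i)]
      refine Finset.sum_congr rfl fun i hi => ?_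
      have hik := Finset.mem_range.1 hi
      rw [h.integrand_reflect_add hik, ← mul_assoc, neg_neg_one_pow_mul_neg_one_pow hik,
        Nat.sub_sub_self (by omega)]

end Reflection

end MeijerG

end

/-- Let `a_{n+1} - b_{m+1} = k` be a positive integer, while `a_i - b_j` is not a positive integer
for all other `i ≤ n + 1`, `j ≤ m + 1`. For `z = exp ω`, and whatever integration paths `γ₁`, `γ₂`
are used for the two `G`-functions, both integrals converge and
`G^{m,n+1}_{p+1,q+1}(z) - (-1)^k G^{m+1,n}_{p+1,q+1}(z)` is the sum over
`c = b_{m+1}, b_{m+1} + 1, …, a_{n+1} - 1` of the terms below. -/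
theorem propositionA1 (p q m n : ℕ) (hn : n ≤ p) (hm : m ≤ q)
    (a : Fin (p + 1) → ℂ) (b : Fin (q + 1) → ℂ)
    (k : ℕ) (hk : 0 < k)
    (hab : a ⟨n, Nat.lt_succ_of_le hn⟩ - b ⟨m, Nat.lt_succ_of_le hm⟩ = (k : ℂ))
    (hsep : ∀ (i : Fin (p + 1)) (j : Fin (q + 1)), i.val ≤ n → j.val ≤ m →
      ¬ (i.val = n ∧ j.val = m) → ∀ r : ℕ, 0 < r → a i - b j ≠ (r : ℂ))
    (ω : ℂ) (γ₁ γ₂ : ℝ → ℂ)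
    (hγ₁ : MeijerG.IsContour m (n + 1) a b ω γ₁)
    (hγ₂ : MeijerG.IsContour (m + 1) n a b ω γ₂) :
    MeijerG.Converges m (n + 1) a b ω γ₁ ∧
    MeijerG.Converges (m + 1) n a b ω γ₂ ∧
    MeijerG.meijerG m (n + 1) a b ω γ₁ - (-1) ^ k * MeijerG.meijerG (m + 1) n a b ω γ₂ =
      ∑ i ∈ Finset.range k,
        let c : ℂ := b ⟨m, Nat.lt_succ_of_le hm⟩ + (i : ℂ)
        (-1) ^ (k - 1 - i) *
          (((∏ l : Fin (q + 1) with l.val < m, Complex.Gamma (b l - c)) *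
              (∏ l : Fin (p + 1) with l.val < n, Complex.Gamma (1 - a l + c))) /
            ((∏ l : Fin (q + 1) with m ≤ l.val, Complex.Gamma (1 - b l + c)) *
              (∏ l : Fin (p + 1) with n ≤ l.val, Complex.Gamma (a l - c)))) *
          Complex.exp (c * ω) := by
  have h : MeijerG.IsResonant a b ⟨n, Nat.lt_succ_of_le hn⟩ ⟨m, Nat.lt_succ_of_le hm⟩ k :=
    ⟨hab, fun i hi j hj hij => hsep i j hi hj fun ⟨hi', hj'⟩ =>
      hij (Prod.ext (Fin.ext hi') (Fin.ext hj'))⟩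
  refine ⟨hγ₁.converges (by omega) (by omega), hγ₂.converges (by omega) (by omega),
    (h.meijerG_sub_meijerG hγ₁ hγ₂).trans (Finset.sum_congr rfl fun i _ => ?_)⟩
  simp only [MeijerG.integrand]
  ring
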